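/- A grading $R=\bigoplus_{g\in G}R_g$ of a unital real algebra $R$ by an abelian group $G$ (with $R_gR_h\subseteq R_{gh}$) is a *division grading* if every nonzero homogeneous element is invertible; its support is always assumed to be the whole of $G$. Gradings $R=\bigoplus_{g\in G}R_g$ and $S=\bigoplus_{h\in H}S_h$ are *weakly isomorphic* if there are an isomorphism of real algebras $\varphi:R\to S$ and an isomorphism of groups $\alpha:G\to H$ with $\varphi(R_g)=S_{\alpha(g)}$ for all $g\in G$. The tensor product $R\otimes_{\mathbb R} S$ is graded by $G\times H$ through $(R\otimes S)_{(g,h)}=R_g\otimes S_h$. Let $A=\begin{pmatrix}1&0\\0&-1\end{pmatrix}$, $B=\begin{pmatrix}0&1\\1&0\end{pmatrix}$, $C=AB=\begin{pmatrix}0&1\\-1&0\end{pmatrix}$ and $\omega=\frac{1}{\sqrt2}(1+i)$. Denote by * $M_2^{(4)}$ the algebra $M_2(\mathbb R)$ graded by $\mathbb Z_2\times\mathbb Z_2$, the component of degree $(a,b)$ being $\mathbb R\,A^aB^b$; * $\mathbb C^{(2)}$ the real algebra $\mathbb C$ graded by $\mathbb Z_2$, with components $\mathbb R$ and $\mathbb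 R i$; * $M_2^{(8)}$ the real algebra $M_2(\mathbb C)$ graded by $\mathbb Z_4\times\mathbb Z_2$, the component of degree $(a,b)$ being $\mathbb R\,(\omega A)^aC^b$; * $\mathbb H$ the real quaternion algebra with the trivial grading (by the trivial group). **Proposition.** Let $n\ge 0$ be an integer. The real algebra $M_n(\mathbb C)$ has a division grading by an abelian group with all components of dimension $4$ over $\mathbb R$ if and only if $n=2^m$ for some integer $m\ge 1$. For every such grading, the identity component $R_e$ is isomorphic to $\mathbb H$ as a real algebra, $n=2^{k+1}$ for some integer $k\ge 0$, and the grading is weakly isomorphic to one of the following: 1. $(M_2^{(4)})^{\otimes k}\otimes\mathbb C^{(2)}\otimes\mathbb H$; 2. $M_2^{(8)}\otimes (M_2^{(4)})^{\otimes (k-1)}\otimes\mathbb H$ (only if $k\ge 1$). -/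

import Mathlib

open scoped TensorProduct Quaternion

/-- A division grading of a (possibly noncommutative) real algebra `R` by an abelian group `G`,
written additively: `R` is the internal direct sum of the `𝒜 g`, `𝒜 g * 𝒜 h ⊆ 𝒜 (g + h)`, and
every nonzero homogeneous element is invertible. -/
structure IsDivisionGrading {G R : Type*} [AddCommGroup G] [Ring R] [Algebra ℝ R]
    (𝒜 : G → Submodule ℝ R) : Prop where
  gradedMonoid : SetLike.GradedMonoid 𝒜
  isInternal : open scoped Classical in DirectSum.IsInternal 𝒜
  isUnit : ∀ (g : G) (x : R), x ∈ 𝒜 g → x ≠ 0 → IsUnit x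

/-- Gradings of `R` by `G` and of `S` by `H` are weakly isomorphic if an isomorphism of algebras
`φ : R → S` and an isomorphism of groups `α : G → H` satisfy `φ (𝒜 g) = ℬ (α g)` for all `g`. -/
def WeaklyIsomorphic {G H R S : Type*} [AddCommGroup G] [AddCommGroup H]
    [Ring R] [Algebra ℝ R] [Ring S] [Algebra ℝ S]
    (𝒜 : G → Submodule ℝ R) (ℬ : H → Submodule ℝ S) : Prop :=
  ∃ (φ : R ≃ₐ[ℝ] S) (α : G ≃+ H), ∀ g : G, (𝒜 g).map φ.toLinearMap = ℬ (α g)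

/-- The tensor product of two gradings: the component of degree `(g, h)` of `R ⊗ S` is the
subspace `R_g ⊗ S_h`, spanned by the `x ⊗ y` with `x ∈ R_g` and `y ∈ S_h`. -/
def tensorGrading {G H R S : Type*} [Ring R] [Algebra ℝ R] [Ring S] [Algebra ℝ S]
    (𝒜 : G → Submodule ℝ R) (ℬ : H → Submodule ℝ S) : G × H → Submodule ℝ (R ⊗[ℝ] S) :=
  fun p => Submodule.span ℝ {z | ∃ x ∈ 𝒜 p.1, ∃ y ∈ ℬ p.2, z = x ⊗ₜ[ℝ] y}

/-- The `k`-th tensor power of a grading of `R` by `G`: a grading of `R ⊗ ⋯ ⊗ R` by `G × ⋯ × G`,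
whose component of degree `(g₁, …, g_k)` is `R_{g₁} ⊗ ⋯ ⊗ R_{g_k}`. -/
def tensorPowerGrading {G R : Type*} [Ring R] [Algebra ℝ R] (𝒜 : G → Submodule ℝ R) (k : ℕ) :
    (Fin k → G) → Submodule ℝ (⨂[ℝ] _ : Fin k, R) :=
  fun g => Submodule.span ℝ
    {z | ∃ x : Fin k → R, (∀ i, x i ∈ 𝒜 (g i)) ∧ z = PiTensorProduct.tprod ℝ x}

/-- The grading `M₂⁽⁴⁾` of `M₂(ℝ)` by `ℤ/2 × ℤ/2`. With `A = diag(1, -1)`, `B = [0 1; 1 0]` and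
`C = A B = [0 1; -1 0]`, the components of degree `(0,0)`, `(1,0)`, `(0,1)`, `(1,1)` are spanned by
`1`, `A`, `B`, `C` respectively. -/
noncomputable def gradingM2four : ZMod 2 × ZMod 2 → Submodule ℝ (Matrix (Fin 2) (Fin 2) ℝ) :=
  fun g => Submodule.span ℝ {!![1, 0; 0, -1] ^ g.1.val * !![0, 1; 1, 0] ^ g.2.val}

/-- The grading `ℂ⁽²⁾` of the real algebra `ℂ` by `ℤ/2`, with components `ℝ` and `ℝ i`. -/
noncomputable def gradingCtwo : ZMod 2 → Submodule ℝ ℂ :=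
  fun g => Submodule.span ℝ {Complex.I ^ g.val}

/-- The grading `M₂⁽⁸⁾` of the real algebra `M₂(ℂ)` by `ℤ/4 × ℤ/2`, with one-dimensional components.
With `ω = (1 + i) / √2`, `A = diag(1, -1)` and `C = [0 1; -1 0]`, the component of degree `(a, b)` is
spanned over `ℝ` by `(ω A) ^ a * C ^ b`. -/
noncomputable def gradingM2eight : ZMod 4 × ZMod 2 → Submodule ℝ (Matrix (Fin 2) (Fin 2) ℂ) :=
  fun g => Submodule.span ℝ
    {(((1 + Complex.I) / (Real.sqrt 2 : ℂ)) • !![1, 0; 0, -1]) ^ g.1.val *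
      !![0, 1; -1, 0] ^ g.2.val}

/-- The quaternions with the trivial grading (by the trivial group). -/
noncomputable def gradingH : Unit → Submodule ℝ ℍ[ℝ] :=
  fun _ => ⊤

/-! The identity component `D` is a four-dimensional real division algebra, so it is `ℍ` by
Frobenius. Averaging over conjugation by `1, i, j, ij` shows that every component contains a nonzero
`x` centralizing `D` (a frame). It is unique up to a real factor, and the component is `x D`. Two
frames commute up to a real scalar, which is a root of unity because `G` is finite, hence a sign.
These signs form an alternating form `b : G × G → ℤ/2`.

The radical of `b` consists of the degrees of central homogeneous elements. The centre `ℂ` of the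
matrix algebra is a graded subspace that meets `D` in `ℝ`, so `J = i·1` is homogeneous of some
degree `e ≠ 0`, and the radical is `{0, e}`. Multiplying a frame by `J` flips the sign of its square
and shifts its degree by `e` without affecting `b`, so squares can be prescribed along a symplectic
basis.

Since `2G` lies in the radical, two cases remain. If `2G = 0`, then `G` is a symplectic space plus
`⟨e⟩`: hyperbolic pairs generate commuting copies of `M₂(ℝ)`, and `J` generates `ℂ`. Otherwise `e =
2a`; some `t` of order two pairs nontrivially with `a`, the frames of `a` and `t` generate `M₂⁽⁸⁾`,
and the orthogonal complement is symplectic. Dimension counts turn the resulting surjections into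
isomorphisms and give `n`. Existence starts from `M₂(ℂ) = ℂ ⊗ ℍ` and tensors repeatedly with
`M₂(ℝ)`. -/

/-! ### Frobenius' theorem for four-dimensional real division algebras -/

section Frobenius

variable {D : Type*} [Ring D] [Algebra ℝ D] [IsDomain D]

/-- Irreducible real polynomials have degree at most two, so `x` is a root of a quadratic, and one
completes the square. If the resulting constant is positive, the difference of squares factors and
`x` is a scalar; then `s = 0`. -/
theorem exists_sub_sq_eq_neg [FiniteDimensional ℝ D] (x : D) :
    ∃ p s : ℝ, (x - p • 1) * (x - p • 1) = -(s * s) • (1 : D) := by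
  have hquad : ∃ p q : ℝ, x * x = p • x + q • 1 := by
    have hint : IsIntegral ℝ x := IsIntegral.of_finite ℝ x
    have hirr := minpoly.irreducible hint
    have hdeg := hirr.degree_le_two
    have hmon := minpoly.monic hint
    have hnat : (minpoly ℝ x).natDegree ≤ 2 := Polynomial.natDegree_le_of_degree_le hdeg
    have hev := minpoly.aeval ℝ x
    rw [Polynomial.aeval_eq_sum_range' (n := 3) (by omega)] at hev
    simp only [Finset.sum_range_succ, Finset.range_zero, Finset.sum_empty, zero_add, pow_zero,
      pow_one, pow_two] at hev
    have hpos := minpoly.natDegree_pos hint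
    rcases (by omega : (minpoly ℝ x).natDegree = 1 ∨ (minpoly ℝ x).natDegree = 2) with h | h
    · have h1 : (minpoly ℝ x).coeff 1 = 1 := by rw [← h]; exact hmon
      have h2 : (minpoly ℝ x).coeff 2 = 0 :=
        Polynomial.coeff_eq_zero_of_natDegree_lt (by omega)
      rw [h1, h2, one_smul, zero_smul, add_zero] at hev
      refine ⟨-(minpoly ℝ x).coeff 0, 0, ?_⟩
      have hx : x = -((minpoly ℝ x).coeff 0 • (1 : D)) := by
        rw [add_comm] at hev; exact eq_neg_of_add_eq_zero_left hev
      generalize (minpoly ℝ x).coeff 0 = c at *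
      subst hx
      simp
    · have h2 : (minpoly ℝ x).coeff 2 = 1 := by rw [← h]; exact hmon
      rw [h2, one_smul] at hev
      refine ⟨-(minpoly ℝ x).coeff 1, -(minpoly ℝ x).coeff 0, ?_⟩
      rw [add_comm] at hev
      rw [eq_neg_of_add_eq_zero_left hev]
      module
  obtain ⟨p, q, hpq⟩ := hquad
  have key : (x - (p / 2) • 1) * (x - (p / 2) • 1) = (q + p ^ 2 / 4) • (1 : D) := by
    simp only [sub_mul, mul_sub, hpq, smul_mul_assoc, mul_smul_comm, one_mul, mul_one]
    module
  rcases le_total (q + p ^ 2 / 4) 0 with h | h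
  · refine ⟨p / 2, √(-(q + p ^ 2 / 4)), ?_⟩
    rw [key, Real.mul_self_sqrt (by linarith), neg_neg]
  · set s := √(q + p ^ 2 / 4) with hs
    have hss : s * s = q + p ^ 2 / 4 := Real.mul_self_sqrt h
    have hprod : (x - (p / 2) • 1 - s • 1) * (x - (p / 2) • 1 + s • 1) = 0 := by
      rw [sub_mul, mul_add, mul_add, key, ← hss]
      simp only [smul_mul_assoc, mul_smul_comm, one_mul, mul_one, smul_smul]
      module
    rcases mul_eq_zero.mp hprod with h0 | h0
    · refine ⟨p / 2 + s, 0, ?_⟩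
      have : x - (p / 2 + s) • (1 : D) = 0 := by rw [← h0]; module
      rw [this]; simp
    · refine ⟨p / 2 - s, 0, ?_⟩
      have : x - (p / 2 - s) • (1 : D) = 0 := by rw [← h0]; module
      rw [this]; simp

theorem exists_smul_sq_eq_neg_one {y : D} {s : ℝ} (hy : y ≠ 0)
    (h : y * y = -(s * s) • (1 : D)) : (s⁻¹ • y) * (s⁻¹ • y) = -1 := by
  have hs : s ≠ 0 := by
    rintro rfl
    simp [hy] at h
  rw [smul_mul_assoc, mul_smul_comm, h, smul_smul, smul_smul]
  rw [show s⁻¹ * s⁻¹ * -(s * s) = -1 by field_simp]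
  simp

theorem exists_notMem_span_pair {D : Type*} [Ring D] [Algebra ℝ D]
    (h4 : Module.finrank ℝ D = 4) (y z : D) :
    ∃ x : D, x ∉ Submodule.span ℝ {y, z} := by
  classical
  by_contra! hall
  have htop : Submodule.span ℝ (({y, z} : Finset D) : Set D) = ⊤ := by
    rw [eq_top_iff]; intro x _; simpa using hall x
  have h1 := finrank_span_finset_le_card (R := ℝ) ({y, z} : Finset D)
  rw [Set.finrank, htop, finrank_top, h4] at h1
  have h2 := Finset.card_le_two (a := y) (b := z)
  omega

/-- Frobenius' theorem in dimension four. -/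
theorem exists_quaternion_algHom_bijective (h4 : Module.finrank ℝ D = 4) :
    ∃ f : ℍ[ℝ] →ₐ[ℝ] D, Function.Bijective f := by
  have : FiniteDimensional ℝ D := Module.finite_of_finrank_eq_succ h4
  obtain ⟨x, hx⟩ := exists_notMem_span_pair h4 (1 : D) 0
  obtain ⟨p, s, hps⟩ := exists_sub_sq_eq_neg x
  have hx0 : x - p • 1 ≠ 0 := fun h => hx <| by
    rw [sub_eq_zero.mp h]
    exact Submodule.smul_mem _ _ (Submodule.subset_span (by simp))
  set i := s⁻¹ • (x - p • 1) with hi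
  have hii : i * i = -1 := exists_smul_sq_eq_neg_one hx0 hps
  clear_value i
  have hi0 : i ≠ 0 := by rintro rfl; simp at hii
  obtain ⟨w, hw⟩ := exists_notMem_span_pair h4 (1 : D) i
  -- Twice the component of `w` that anticommutes with `i`.
  set u := w + i * w * i with hu
  have hiu : i * u = i * w - w * i := by
    rw [hu, mul_add, ← mul_assoc, ← mul_assoc, hii]; noncomm_ring
  have hui : u * i = -(i * u) := by
    rw [hiu, hu, add_mul, mul_assoc (i * w), hii]; noncomm_ring
  -- If `u = 0`, then `w` commutes with `i`, so `(w - p)² + s²` factors over `ℝ + ℝ i` and `w` lies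
  -- in that plane.
  have hu0 : u ≠ 0 := by
    intro h0
    rw [h0, mul_zero] at hiu
    have hcomm : i * w = w * i := (sub_eq_zero.mp hiu.symm)
    obtain ⟨p, s, hps⟩ := exists_sub_sq_eq_neg w
    have hprod : (w - p • 1 - s • i) * (w - p • 1 + s • i) = 0 := by
      rw [sub_mul (w - p • 1), mul_add, mul_add, hps]
      simp only [sub_mul, mul_sub, smul_mul_assoc, mul_smul_comm, one_mul, mul_one, hii, hcomm]
      module
    have h1 : (1 : D) ∈ Submodule.span ℝ {1, i} := Submodule.subset_span (by simp)
    have h2 : i ∈ Submodule.span ℝ {1, i} := Submodule.subset_span (by simp)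
    apply hw
    rcases mul_eq_zero.mp hprod with h0 | h0
    · rw [show w = p • 1 + s • i by rw [← sub_eq_zero, ← h0]; abel]
      exact add_mem (Submodule.smul_mem _ _ h1) (Submodule.smul_mem _ _ h2)
    · rw [show w = p • 1 - s • i by rw [← sub_eq_zero, ← h0]; abel]
      exact sub_mem (Submodule.smul_mem _ _ h1) (Submodule.smul_mem _ _ h2)
  obtain ⟨q, t, hqt⟩ := exists_sub_sq_eq_neg u
  -- `u²` commutes with `i` while `u` anticommutes with it, so the quadratic equation of `u` has no
  -- linear term.
  have hq : q = 0 := by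
    have huu : u * u = (2 * q) • u + (-(t * t) - q * q) • 1 := by
      simp only [sub_mul, mul_sub, smul_mul_assoc, mul_smul_comm, one_mul, mul_one] at hqt
      linear_combination (norm := module) hqt
    have hc : i * (u * u) = (u * u) * i := by
      rw [mul_assoc u u i, hui, mul_neg, ← mul_assoc u i u, hui, neg_mul, neg_neg, mul_assoc]
    rw [huu, mul_add, add_mul, mul_smul_comm, smul_mul_assoc, hui] at hc
    simp only [smul_mul_assoc, mul_smul_comm, one_mul, mul_one] at hc
    have : (4 * q) • (i * u) = 0 := by linear_combination (norm := module) hc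
    simpa [hi0, hu0] using this
  rw [hq, zero_smul, sub_zero] at hqt
  set j := t⁻¹ • u with hj
  have hjj : j * j = -1 := exists_smul_sq_eq_neg_one hu0 hqt
  have hji : j * i = -(i * j) := by
    rw [hj, smul_mul_assoc, hui, mul_smul_comm, smul_neg]
  let B : QuaternionAlgebra.Basis D (-1 : ℝ) 0 (-1) :=
    { i := i, j := j, k := i * j
      i_mul_i := by simp [hii]
      j_mul_j := by simp [hjj]
      i_mul_j := rfl
      j_mul_i := by simp [hji] }
  let f : ℍ[ℝ] →ₐ[ℝ] D := B.liftHom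
  have hinj : Function.Injective f := (f : ℍ[ℝ] →+* D).injective
  exact ⟨f, hinj, (LinearMap.injective_iff_surjective_of_finrank_eq_finrank
    (f := f.toLinearMap) (by rw [h4]; exact Quaternion.finrank_eq_four)).mp hinj⟩

end Frobenius

/-! ### Division gradings, frames and their commutation signs -/

section Grading

variable {G R : Type*} [AddCommGroup G] [Ring R] [Algebra ℝ R] {𝒜 : G → Submodule ℝ R}

theorem exists_quaternion_components (a b c d : ℝ) :
    ∃ q : ℍ[ℝ], q.re = a ∧ q.imI = b ∧ q.imJ = c ∧ q.imK = d :=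
  ⟨⟨a, b, c, d⟩, rfl, rfl, rfl, rfl⟩

namespace IsDivisionGrading

theorem one_mem (h : IsDivisionGrading 𝒜) : (1 : R) ∈ 𝒜 0 :=
  h.gradedMonoid.one_mem

theorem mul_mem (h : IsDivisionGrading 𝒜) {g g' : G} {x y : R} (hx : x ∈ 𝒜 g) (hy : y ∈ 𝒜 g') :
    x * y ∈ 𝒜 (g + g') :=
  h.gradedMonoid.mul_mem hx hy

theorem pow_mem (h : IsDivisionGrading 𝒜) {g : G} {x : R} (hx : x ∈ 𝒜 g) (n : ℕ) :
    x ^ n ∈ 𝒜 (n • g) := by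
  induction n with
  | zero => simpa using h.one_mem
  | succ n ih => rw [pow_succ, succ_nsmul]; exact h.mul_mem ih hx

theorem iSupIndep (h : IsDivisionGrading 𝒜) : iSupIndep 𝒜 := by
  classical
  have := h.isInternal.submodule_iSupIndep
  exact this

theorem iSup_eq_top (h : IsDivisionGrading 𝒜) : ⨆ g, 𝒜 g = ⊤ := by
  classical
  have := h.isInternal.submodule_iSup_eq_top
  exact this

theorem eq_top_of_le (h : IsDivisionGrading 𝒜) {P : Submodule ℝ R} (hP : ∀ g, 𝒜 g ≤ P) : P = ⊤ :=
  top_le_iff.mp (h.iSup_eq_top ▸ iSup_le hP)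

/-- Directness of the sum in the form used below; the degrees `g₁` and `g₂` may coincide. -/
theorem eq_zero_of_eq_add (h : IsDivisionGrading 𝒜) {g g₁ g₂ : G} {x y z : R} (hx : x ∈ 𝒜 g)
    (hy : y ∈ 𝒜 g₁) (hz : z ∈ 𝒜 g₂) (h₁ : g₁ ≠ g) (h₂ : g₂ ≠ g) (hxyz : x = y + z) : x = 0 := by
  refine Submodule.disjoint_def.mp (h.iSupIndep g) x hx ?_
  rw [hxyz]
  exact add_mem (Submodule.mem_iSup_of_mem g₁ (Submodule.mem_iSup_of_mem h₁ hy))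
    (Submodule.mem_iSup_of_mem g₂ (Submodule.mem_iSup_of_mem h₂ hz))

theorem degree_eq (h : IsDivisionGrading 𝒜) {g g' : G} {x : R} (hx : x ∈ 𝒜 g) (hx' : x ∈ 𝒜 g')
    (hx0 : x ≠ 0) : g = g' := by
  by_contra hne
  exact hx0 (h.eq_zero_of_eq_add hx hx' (zero_mem (𝒜 g')) (Ne.symm hne) (Ne.symm hne)
    (add_zero x).symm)

theorem finite_of_finiteDimensional (h : IsDivisionGrading 𝒜) [FiniteDimensional ℝ R]
    (hne : ∀ g, 𝒜 g ≠ ⊥) : Finite G := by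
  have := WellFoundedGT.finite_ne_bot_of_iSupIndep h.iSupIndep
  simpa [hne, Set.finite_univ_iff] using this

theorem finrank_eq_mul_card (h : IsDivisionGrading 𝒜) [Finite G] [FiniteDimensional ℝ R] {d : ℕ}
    (hd : ∀ g, Module.finrank ℝ (𝒜 g) = d) : Module.finrank ℝ R = Nat.card G * d := by
  classical
  cases nonempty_fintype G
  rw [← (LinearEquiv.ofBijective (DirectSum.coeLinearMap 𝒜) h.isInternal).finrank_eq,
    Module.finrank_directSum]
  simp [hd]

/-- Left multiplication by the unit `u` is injective between components of equal dimension, hence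
onto. Writing the dimension as `d + 1` ensures that it is finite. -/
theorem exists_eq_mul (h : IsDivisionGrading 𝒜) {d : ℕ} (hd : ∀ g, Module.finrank ℝ (𝒜 g) = d + 1)
    {g g' : G} {u x : R} (hu : u ∈ 𝒜 g) (hu0 : u ≠ 0) (hx : x ∈ 𝒜 (g + g')) :
    ∃ y ∈ 𝒜 g', x = u * y := by
  have hfin (g : G) : FiniteDimensional ℝ (𝒜 g) := Module.finite_of_finrank_eq_succ (hd g)
  let L : 𝒜 g' →ₗ[ℝ] 𝒜 (g + g') :=
    (LinearMap.mulLeft ℝ u).restrict fun y hy => h.mul_mem hu hy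
  have hL : Function.Injective L := by
    intro y z hyz
    have : u * y = u * z := congrArg Subtype.val hyz
    exact Subtype.ext ((h.isUnit g u hu hu0).mul_right_injective this)
  obtain ⟨y, hy⟩ := (LinearMap.injective_iff_surjective_of_finrank_eq_finrank
    (by rw [hd, hd])).mp hL ⟨x, hx⟩
  exact ⟨y, y.2, (congrArg Subtype.val hy).symm⟩

/-- An identity component of dimension four is a copy of the quaternions. -/
theorem exists_quaternion_algHom (h : IsDivisionGrading 𝒜)
    (h4 : ∀ g, Module.finrank ℝ (𝒜 g) = 4) :
    ∃ f : ℍ[ℝ] →ₐ[ℝ] R, Function.Injective f ∧ LinearMap.range f.toLinearMap = 𝒜 0 := by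
  let D : Subalgebra ℝ R := (𝒜 0).toSubalgebra h.one_mem fun x y hx hy => by
    simpa using h.mul_mem hx hy
  have hD : Module.finrank ℝ D = 4 := h4 0
  have : Nontrivial D := Module.nontrivial_of_finrank_pos (R := ℝ) (by omega)
  have : NoZeroDivisors D := ⟨fun {a b} hab => by
    by_contra! hne
    have ha := h.isUnit 0 a a.2 (by simpa using hne.1)
    exact hne.2 (Subtype.ext (ha.mul_right_eq_zero.mp (congrArg Subtype.val hab)))⟩
  have : IsDomain D := NoZeroDivisors.to_isDomain D
  obtain ⟨f, hinj, hsurj⟩ := exists_quaternion_algHom_bijective hD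
  refine ⟨D.val.comp f, Subtype.val_injective.comp hinj, le_antisymm ?_ ?_⟩
  · rintro _ ⟨q, rfl⟩
    exact (f q).2
  · intro x hx
    obtain ⟨q, hq⟩ := hsurj ⟨x, hx⟩
    exact ⟨q, congrArg Subtype.val hq⟩

end IsDivisionGrading

/-- A division grading together with an identification of its identity component with `ℍ`. -/
structure IsQuaternionGrading (𝒜 : G → Submodule ℝ R) (f : ℍ[ℝ] →ₐ[ℝ] R) : Prop
    extends IsDivisionGrading 𝒜 where
  finrank_eq : ∀ g, Module.finrank ℝ (𝒜 g) = 4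
  injective : Function.Injective f
  range_eq : LinearMap.range f.toLinearMap = 𝒜 0

/-- A nonzero homogeneous element centralizing the quaternions. -/
structure IsFrame (𝒜 : G → Submodule ℝ R) (f : ℍ[ℝ] →ₐ[ℝ] R) (g : G) (x : R) : Prop where
  mem : x ∈ 𝒜 g
  ne_zero : x ≠ 0
  comm : ∀ q, Commute x (f q)

theorem IsFrame.smul {G : Type*} {𝒜 : G → Submodule ℝ R} {f : ℍ[ℝ] →ₐ[ℝ] R} {g : G} {x : R}
    (hx : IsFrame 𝒜 f g x) {r : ℝ} (hr : r ≠ 0) :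
    IsFrame 𝒜 f g (r • x) :=
  ⟨Submodule.smul_mem _ _ hx.mem, smul_ne_zero hr hx.ne_zero, fun q => (hx.comm q).smul_left r⟩

namespace IsQuaternionGrading

variable {f : ℍ[ℝ] →ₐ[ℝ] R} (h : IsQuaternionGrading 𝒜 f)
include h

theorem nontrivial : Nontrivial R :=
  ⟨f 0, f 1, fun h01 => zero_ne_one (h.injective h01)⟩

theorem map_mem (q : ℍ[ℝ]) : f q ∈ 𝒜 0 := h.range_eq ▸ ⟨q, rfl⟩

theorem exists_eq_map {x : R} (hx : x ∈ 𝒜 0) : ∃ q, x = f q := by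
  rw [← h.range_eq] at hx
  obtain ⟨q, hq⟩ := hx
  exact ⟨q, hq.symm⟩

theorem isUnit_frame {g : G} {x : R} (hx : IsFrame 𝒜 f g x) : IsUnit x :=
  h.isUnit g x hx.mem hx.ne_zero

theorem frame_mul {g g' : G} {x y : R} (hx : IsFrame 𝒜 f g x) (hy : IsFrame 𝒜 f g' y) :
    IsFrame 𝒜 f (g + g') (x * y) :=
  ⟨h.mul_mem hx.mem hy.mem,
    fun h0 => hy.ne_zero ((h.isUnit_frame hx).mul_right_eq_zero.mp h0),
    fun q => (hx.comm q).mul_left (hy.comm q)⟩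

theorem frame_one : IsFrame 𝒜 f 0 1 :=
  have := h.nontrivial
  ⟨h.one_mem, one_ne_zero, fun _ => Commute.one_left _⟩

theorem frame_pow {g : G} {x : R} (hx : IsFrame 𝒜 f g x) (n : ℕ) :
    IsFrame 𝒜 f (n • g) (x ^ n) := by
  induction n with
  | zero => simpa using h.frame_one
  | succ n ih => rw [pow_succ, succ_nsmul]; exact h.frame_mul ih hx

/-- The centre of `ℍ` is `ℝ`; commuting with `i` and `j` already kills the imaginary coordinates. -/
theorem exists_eq_smul_one {x : R} (hx : x ∈ 𝒜 0) (hc : ∀ q, Commute x (f q)) :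
    ∃ r : ℝ, x = r • 1 := by
  obtain ⟨p, rfl⟩ := h.exists_eq_map hx
  have hp (q : ℍ[ℝ]) : p * q = q * p := h.injective (by simpa using (hc q).eq)
  refine ⟨p.re, ?_⟩
  rw [← map_one f, ← map_smul]
  congr 1
  obtain ⟨qi, hi⟩ := exists_quaternion_components 0 1 0 0
  obtain ⟨qj, hj⟩ := exists_quaternion_components 0 0 1 0
  have h1 := hp qi
  have h2 := hp qj
  simp only [Quaternion.ext_iff, Quaternion.re_mul, Quaternion.imI_mul, Quaternion.imJ_mul,
    Quaternion.imK_mul, hi, hj] at h1 h2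
  ext <;> simp <;> linarith

/-- The quotient `x⁻¹ y` has degree `0` and centralizes the quaternions, so it is real. -/
theorem exists_eq_smul {g : G} {x y : R} (hx : IsFrame 𝒜 f g x) (hy : y ∈ 𝒜 g)
    (hc : ∀ q, Commute y (f q)) : ∃ r : ℝ, y = r • x := by
  obtain ⟨z, hz, rfl⟩ := h.exists_eq_mul (d := 3) h.finrank_eq (g' := 0) hx.mem hx.ne_zero
    (by simpa using hy)
  obtain ⟨r, rfl⟩ := h.exists_eq_smul_one hz fun q => by
    have := hc q
    refine (h.isUnit_frame hx).mul_right_injective ?_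
    change x * (z * f q) = x * (f q * z)
    rw [← mul_assoc, this.eq, ← mul_assoc, ← (hx.comm q).eq, mul_assoc]
  exact ⟨r, by simp⟩

/-- A sum of conjugates projects each component to the centralizer of `ℍ`. An element is recovered
from the projections of its multiples by `1, i, j, ij`, so they cannot all vanish. -/
theorem exists_frame (g : G) : ∃ x, IsFrame 𝒜 f g x := by
  obtain ⟨qi, hqi⟩ := exists_quaternion_components 0 1 0 0
  obtain ⟨qj, hqj⟩ := exists_quaternion_components 0 0 1 0
  have hqii : qi * qi = -1 := by ext <;> simp [hqi]
  have hqjj : qj * qj = -1 := by ext <;> simp [hqj]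
  have hqji : qj * qi = -(qi * qj) := by ext <;> simp [hqi, hqj]
  have hq (q : ℍ[ℝ]) : q = q.re • 1 + q.imI • qi + q.imJ • qj + q.imK • (qi * qj) := by
    ext <;> simp [hqi, hqj]
  set i := f qi with hi
  set j := f qj with hj
  have hii : i * i = -1 := by rw [hi, ← map_mul, hqii]; simp
  have hjj : j * j = -1 := by rw [hj, ← map_mul, hqjj]; simp
  have hji : j * i = -(i * j) := by rw [hi, hj, ← map_mul, hqji]; simp
  have hii' (z : R) : i * (i * z) = -z := by rw [← mul_assoc, hii]; simp
  have hjj' (z : R) : j * (j * z) = -z := by rw [← mul_assoc, hjj]; simp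
  have hji' (z : R) : j * (i * z) = -(i * (j * z)) := by rw [← mul_assoc, hji]; simp [mul_assoc]
  -- As `i⁻¹ = -i`, and likewise for `j` and `ij`, this is the sum of the conjugates of `x` by `1,
  -- i, j, ij`.
  let P (x : R) : R := x - i * x * i - j * x * j - (i * j) * x * (i * j)
  have hPi (x : R) : Commute (P x) i := by
    simp only [Commute, SemiconjBy, P, sub_mul, mul_sub, mul_assoc, hii, hji, hii',
      mul_neg, mul_one, neg_neg]
    abel
  have hPj (x : R) : Commute (P x) j := by
    simp only [Commute, SemiconjBy, P, sub_mul, mul_sub, mul_assoc, hjj, hjj', hji',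
      mul_neg, mul_one, neg_neg]
    abel
  have hP (x : R) : (4 : ℝ) • x = P x - P (x * i) * i - P (x * j) * j - P (x * (i * j)) * (i * j) := by
    simp only [P, sub_mul, mul_assoc, hii, hji, hjj, hii', hji',
      mul_neg, neg_mul, mul_one, neg_neg]
    module
  have hPmem {x : R} (hx : x ∈ 𝒜 g) : P x ∈ 𝒜 g := by
    have hl (q : ℍ[ℝ]) {x : R} (hx : x ∈ 𝒜 g) : f q * x ∈ 𝒜 g := by
      simpa using h.mul_mem (h.map_mem q) hx
    have hr (q : ℍ[ℝ]) {x : R} (hx : x ∈ 𝒜 g) : x * f q ∈ 𝒜 g := by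
      simpa using h.mul_mem hx (h.map_mem q)
    have hij : i * j = f (qi * qj) := by simp [hi, hj]
    simp only [P, hij]
    exact sub_mem (sub_mem (sub_mem hx (hr _ (hl _ hx))) (hr _ (hl _ hx))) (hr _ (hl _ hx))
  have hframe {x : R} (hx : x ∈ 𝒜 g) (h0 : P x ≠ 0) : IsFrame 𝒜 f g (P x) := by
    refine ⟨hPmem hx, h0, fun q => ?_⟩
    rw [hq q]
    simp only [map_add, map_smul, map_mul, map_one, ← hi, ← hj]
    exact ((((Commute.one_right _).smul_right _).add_right ((hPi x).smul_right _)).add_right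
      ((hPj x).smul_right _)).add_right (((hPi x).mul_right (hPj x)).smul_right _)
  have hr (q : ℍ[ℝ]) {x : R} (hx : x ∈ 𝒜 g) : x * f q ∈ 𝒜 g := by
    simpa using h.mul_mem hx (h.map_mem q)
  have : Nontrivial (𝒜 g) := Module.nontrivial_of_finrank_pos (R := ℝ) (by rw [h.finrank_eq]; simp)
  obtain ⟨⟨x, hx⟩, hx0⟩ := exists_ne (0 : 𝒜 g)
  by_contra! hall
  have hz {x : R} (hx : x ∈ 𝒜 g) : P x = 0 := by
    by_contra h0
    exact hall _ (hframe hx h0)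
  apply hx0
  have h4 := hP x
  have hij : i * j = f (qi * qj) := by simp [hi, hj]
  rw [hz hx, hz (hr qi hx), hz (hr qj hx), hij, hz (hr (qi * qj) hx)] at h4
  simpa using h4

/-- Both products are frames of the same degree, so `x y = r y x` with `r` real. A power of `x` by
the order of `G` has degree `0` and is a real scalar, so `r` is a real root of unity. -/
theorem mul_eq_or_eq_neg [Finite G] {g g' : G} {x y : R} (hx : IsFrame 𝒜 f g x)
    (hy : IsFrame 𝒜 f g' y) : x * y = y * x ∨ x * y = -(y * x) := by
  have hyx : IsFrame 𝒜 f (g + g') (y * x) := add_comm g g' ▸ h.frame_mul hy hx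
  have hxy := h.frame_mul hx hy
  obtain ⟨r, hr⟩ := h.exists_eq_smul hyx hxy.mem hxy.comm
  have hpow (n : ℕ) : x ^ n * y = r ^ n • (y * x ^ n) := by
    induction n with
    | zero => simp
    | succ n ih =>
      rw [pow_succ', mul_assoc, ih, mul_smul_comm, ← mul_assoc, hr, smul_mul_assoc, smul_smul,
        ← pow_succ, mul_assoc]
  have hN := h.frame_pow hx (Nat.card G)
  rw [card_nsmul_eq_zero'] at hN
  obtain ⟨c, hc⟩ := h.exists_eq_smul_one hN.mem hN.comm
  have hc0 : c ≠ 0 := by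
    rintro rfl
    exact hN.ne_zero (by simp [hc])
  have hrN : r ^ Nat.card G = 1 := by
    have := hpow (Nat.card G)
    rw [hc, smul_mul_assoc, mul_smul_comm, one_mul, mul_one, smul_smul] at this
    have := smul_left_injective ℝ hy.ne_zero this
    exact (mul_eq_right₀ hc0).mp this.symm
  rcases pow_eq_one_iff_cases.mp hrN with h0 | h1 | h1
  · exact absurd h0 Nat.card_pos.ne'
  · left; simpa [h1] using hr
  · right; simpa [h1.1] using hr

end IsQuaternionGrading

/-- The sign attached to an element of `ℤ/2`. -/
noncomputable def zmodSign (s : ZMod 2) : ℝ := if s = 0 then 1 else -1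

theorem zmodSign_add (s t : ZMod 2) : zmodSign (s + t) = zmodSign s * zmodSign t := by
  have h2 (s : ZMod 2) : s = 0 ∨ s = 1 := by revert s; decide
  have h11 : (1 + 1 : ZMod 2) = 0 := by decide
  rcases h2 s with rfl | rfl <;> rcases h2 t with rfl | rfl <;> simp [zmodSign, h11]

theorem zmodSign_injective : Function.Injective zmodSign := by
  intro s t hst
  have h2 (s : ZMod 2) : s = 0 ∨ s = 1 := by revert s; decide
  rcases h2 s with rfl | rfl <;> rcases h2 t with rfl | rfl <;>
    first | rfl | norm_num [zmodSign] at hst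

namespace IsQuaternionGrading

variable {f : ℍ[ℝ] →ₐ[ℝ] R}

/-- The commutation factor of a grading with quaternionic identity component. -/
theorem exists_commutation (h : IsQuaternionGrading 𝒜 f) [Finite G] :
    ∃ b : G →+ G →+ ZMod 2, (∀ g, b g g = 0) ∧
      ∀ g g' x y, IsFrame 𝒜 f g x → IsFrame 𝒜 f g' y → x * y = zmodSign (b g g') • (y * x) := by
  choose X hX using h.exists_frame
  -- Frames of a given degree differ by real factors, which cancel: the sign depends on the degrees
  -- alone.
  have hex (g g' : G) : ∃ s : ZMod 2, ∀ x y, IsFrame 𝒜 f g x → IsFrame 𝒜 f g' y →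
      x * y = zmodSign s • (y * x) := by
    have hs : ∃ s : ZMod 2, X g * X g' = zmodSign s • (X g' * X g) := by
      rcases h.mul_eq_or_eq_neg (hX g) (hX g') with h1 | h1
      · exact ⟨0, by simpa [zmodSign] using h1⟩
      · exact ⟨1, by simpa [zmodSign] using h1⟩
    obtain ⟨s, hs⟩ := hs
    refine ⟨s, fun x y hx hy => ?_⟩
    obtain ⟨r, rfl⟩ := h.exists_eq_smul (hX g) hx.mem hx.comm
    obtain ⟨t, rfl⟩ := h.exists_eq_smul (hX g') hy.mem hy.comm
    simp only [smul_mul_assoc, mul_smul_comm, hs, smul_smul]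
    congr 1
    ring
  choose b hb using hex
  -- A single pair of frames determines the sign; biadditivity follows by testing on products of
  -- frames.
  have huniq {g g' : G} {s : ZMod 2} {x y : R} (hx : IsFrame 𝒜 f g x) (hy : IsFrame 𝒜 f g' y)
      (hs : x * y = zmodSign s • (y * x)) : b g g' = s := by
    apply zmodSign_injective
    refine smul_left_injective ℝ (h.frame_mul hy hx).ne_zero ?_
    exact (hb g g' x y hx hy).symm.trans hs
  have hadd_left (g₁ g₂ g : G) : b (g₁ + g₂) g = b g₁ g + b g₂ g := by
    refine huniq (h.frame_mul (hX g₁) (hX g₂)) (hX g) ?_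
    rw [mul_assoc, hb _ _ _ _ (hX g₂) (hX g), mul_smul_comm, ← mul_assoc,
      hb _ _ _ _ (hX g₁) (hX g), smul_mul_assoc, smul_smul, zmodSign_add, mul_assoc, mul_comm]
  have hadd_right (g g₁ g₂ : G) : b g (g₁ + g₂) = b g g₁ + b g g₂ := by
    refine huniq (hX g) (h.frame_mul (hX g₁) (hX g₂)) ?_
    rw [← mul_assoc, hb _ _ _ _ (hX g) (hX g₁), smul_mul_assoc, mul_assoc,
      hb _ _ _ _ (hX g) (hX g₂), mul_smul_comm, smul_smul, zmodSign_add, mul_assoc]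
  refine ⟨AddMonoidHom.mk' (fun g => AddMonoidHom.mk' (b g) (hadd_right g)) fun g₁ g₂ => ?_,
    fun g => ?_, hb⟩
  · ext g; exact hadd_left g₁ g₂ g
  · exact huniq (hX g) (hX g) (by simp [zmodSign])

end IsQuaternionGrading

end Grading

/-! ### Alternating `ℤ/2`-valued forms on finite abelian groups -/

section Symplectic

theorem ZMod.two_eq_zero_or_one (s : ZMod 2) : s = 0 ∨ s = 1 := by
  revert s; decide

theorem ZMod.two_add_self (s : ZMod 2) : s + s = 0 := by
  revert s; decide

variable {G : Type*} [AddCommGroup G]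

/-- The homomorphism from `ℤ/n` sending `1` to an element killed by `n`. -/
noncomputable def zmodHom (n : ℕ) (a : G) (h : n • a = 0) : ZMod n →+ G :=
  ZMod.lift n ⟨zmultiplesHom G a, by simpa using h⟩

@[simp]
theorem zmodHom_natCast (n : ℕ) (a : G) (h : n • a = 0) (m : ℕ) : zmodHom n a h m = m • a := by
  have := ZMod.lift_coe n ⟨zmultiplesHom G a, by simpa using h⟩ (m : ℤ)
  simpa [zmodHom] using this

@[simp]
theorem zmodHom_one (n : ℕ) (a : G) (h : n • a = 0) : zmodHom n a h 1 = a := by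
  simpa using zmodHom_natCast n a h 1

theorem AddMonoidHom.zmod_two_apply (φ : ZMod 2 →+ ZMod 2) (s : ZMod 2) : φ s = s * φ 1 := by
  rcases ZMod.two_eq_zero_or_one s with rfl | rfl <;> simp

/-- The standard symplectic form on `(ℤ/2)^{2k}`. -/
def symplecticForm {k : ℕ} (u v : Fin k → ZMod 2 × ZMod 2) : ZMod 2 :=
  ∑ i, ((u i).1 * (v i).2 + (u i).2 * (v i).1)

/-- An isometry from a standard symplectic space into `G`, whose values on the standard basis
satisfy `P`. -/
structure IsSymplecticFamily (b : G →+ G →+ ZMod 2) (P : G → Prop) {k : ℕ}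
    (γ : (Fin k → ZMod 2 × ZMod 2) →+ G) : Prop where
  form : ∀ u v, b (γ u) (γ v) = symplecticForm u v
  left : ∀ i, P (γ (Pi.single i (1, 0)))
  right : ∀ i, P (γ (Pi.single i (0, 1)))

theorem symplecticForm_single_left {k : ℕ} (u : Fin k → ZMod 2 × ZMod 2) (i : Fin k) :
    symplecticForm u (Pi.single i (1, 0)) = (u i).2 := by
  rw [symplecticForm, Finset.sum_eq_single i] <;> simp +contextual [Pi.single_eq_of_ne]

theorem symplecticForm_single_right {k : ℕ} (u : Fin k → ZMod 2 × ZMod 2) (i : Fin k) :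
    symplecticForm u (Pi.single i (0, 1)) = (u i).1 := by
  rw [symplecticForm, Finset.sum_eq_single i] <;> simp +contextual [Pi.single_eq_of_ne]

theorem eq_zero_of_symplecticForm {k : ℕ} {u : Fin k → ZMod 2 × ZMod 2}
    (hu : ∀ v, symplecticForm u v = 0) : u = 0 := by
  funext i
  exact Prod.ext ((symplecticForm_single_right u i).symm.trans (hu _))
    ((symplecticForm_single_left u i).symm.trans (hu _))

/-- Nondegeneracy: every functional is represented by the form. The coordinates are swapped because
pairing with `(1, 0)` reads off the second one. -/
theorem symplecticForm_of_hom {k : ℕ} (φ : (Fin k → ZMod 2 × ZMod 2) →+ ZMod 2)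
    (v : Fin k → ZMod 2 × ZMod 2) :
    symplecticForm (fun i => (φ (Pi.single i (0, 1)), φ (Pi.single i (1, 0)))) v = φ v := by
  conv_rhs => rw [← Finset.univ_sum_single v, map_sum]
  refine Finset.sum_congr rfl fun i _ => ?_
  let S : ZMod 2 × ZMod 2 →+ (Fin k → ZMod 2 × ZMod 2) :=
    AddMonoidHom.single (fun _ => ZMod 2 × ZMod 2) i
  have h1 := (φ.comp (S.comp (AddMonoidHom.inl _ _))).zmod_two_apply (v i).1
  have h2 := (φ.comp (S.comp (AddMonoidHom.inr _ _))).zmod_two_apply (v i).2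
  have h3 : S (v i) = S ((v i).1, 0) + S (0, (v i).2) := by rw [← map_add]; simp
  have h4 := congrArg φ h3
  simp only [AddMonoidHom.comp_apply, AddMonoidHom.inl_apply, AddMonoidHom.inr_apply] at h1 h2
  rw [map_add, h1, h2] at h4
  simp only [S, AddMonoidHom.single_apply] at h4
  rw [h4]
  ring

theorem two_nsmul_map_eq_zero {k : ℕ} (γ : (Fin k → ZMod 2 × ZMod 2) →+ G)
    (u : Fin k → ZMod 2 × ZMod 2) : γ u + γ u = 0 := by
  rw [← map_add, show u + u = 0 from funext fun i => Prod.ext (ZMod.two_add_self _)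
    (ZMod.two_add_self _), map_zero]

variable {b : G →+ G →+ ZMod 2} {P : G → Prop}

theorem form_comm (halt : ∀ g, b g g = 0) (g g' : G) : b g g' = b g' g := by
  have h := halt (g + g')
  simp only [map_add, AddMonoidHom.add_apply, halt, zero_add, add_zero] at h
  generalize b g g' = s at *
  generalize b g' g = t at *
  revert s t; decide

namespace IsSymplecticFamily

variable {k : ℕ} {γ : (Fin k → ZMod 2 × ZMod 2) →+ G}

theorem injective (hγ : IsSymplecticFamily b P γ) : Function.Injective γ := by
  refine (injective_iff_map_eq_zero γ).mpr fun u hu => eq_zero_of_symplecticForm fun v => ?_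
  rw [← hγ.form, hu]
  simp

/-- Orthogonal projection: `u` represents the functional `v ↦ b g (γ v)`, and in characteristic two
adding `γ u` cancels it. -/
theorem exists_orthogonal (hγ : IsSymplecticFamily b P γ) (g : G) :
    ∃ u, ∀ v, b (g + γ u) (γ v) = 0 := by
  refine ⟨fun i => ((b g).comp γ (Pi.single i (0, 1)), (b g).comp γ (Pi.single i (1, 0))),
    fun v => ?_⟩
  rw [map_add, AddMonoidHom.add_apply, hγ.form, symplecticForm_of_hom]
  exact ZMod.two_add_self _

/-- The hyperbolic plane spanned by `a` and `c` is orthogonal to the image of `γ` and is added as a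
new coordinate `0`. -/
theorem exists_extension (hγ : IsSymplecticFamily b P γ) (halt : ∀ g, b g g = 0) {a c : G}
    (ha : 2 • a = 0) (hc : 2 • c = 0) (hac : b a c = 1) (haγ : ∀ v, b a (γ v) = 0)
    (hcγ : ∀ v, b c (γ v) = 0) (hPa : P a) (hPc : P c) :
    ∃ γ' : (Fin (k + 1) → ZMod 2 × ZMod 2) →+ G, IsSymplecticFamily b P γ' := by
  let T : (Fin (k + 1) → ZMod 2 × ZMod 2) →+ (Fin k → ZMod 2 × ZMod 2) :=
    AddMonoidHom.mk' (fun v i => v i.succ) fun _ _ => rfl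
  let ζ : ZMod 2 × ZMod 2 →+ G := (zmodHom 2 a ha).coprod (zmodHom 2 c hc)
  let γ' := ζ.comp (Pi.evalAddMonoidHom _ 0) + γ.comp T
  have hγ' (v) : γ' v = ζ (v 0) + γ (T v) := rfl
  have hζ (p : ZMod 2 × ZMod 2) : ζ p = zmodHom 2 a ha p.1 + zmodHom 2 c hc p.2 := rfl
  have hζγ (p v) : b (ζ p) (γ v) = 0 := by
    rw [hζ]
    rcases ZMod.two_eq_zero_or_one p.1 with h1 | h1 <;>
      rcases ZMod.two_eq_zero_or_one p.2 with h2 | h2 <;> simp [h1, h2, haγ, hcγ]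
  have hca : b c a = 1 := by rw [form_comm halt, hac]
  have hζζ (p q) : b (ζ p) (ζ q) = p.1 * q.2 + p.2 * q.1 := by
    rw [hζ, hζ]
    rcases ZMod.two_eq_zero_or_one p.1 with h1 | h1 <;>
      rcases ZMod.two_eq_zero_or_one p.2 with h2 | h2 <;>
      rcases ZMod.two_eq_zero_or_one q.1 with h3 | h3 <;>
      rcases ZMod.two_eq_zero_or_one q.2 with h4 | h4 <;>
      simp [h1, h2, h3, h4, hac, hca, halt]
  have hT0 (x : ZMod 2 × ZMod 2) : T (Pi.single 0 x) = 0 := by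
    funext i; simp [T]
  have hTs (i : Fin k) (x : ZMod 2 × ZMod 2) : T (Pi.single i.succ x) = Pi.single i x := by
    funext j
    simp [T, Pi.single_apply]
  have hs (i : Fin k) (x : ZMod 2 × ZMod 2) : γ' (Pi.single i.succ x) = γ (Pi.single i x) := by
    rw [hγ', hTs, Pi.single_eq_of_ne (Fin.succ_ne_zero i).symm, map_zero, zero_add]
  have h0 (x : ZMod 2 × ZMod 2) : γ' (Pi.single 0 x) = ζ x := by
    rw [hγ', hT0]; simp
  refine ⟨γ', ⟨fun u v => ?_, fun i => ?_, fun i => ?_⟩⟩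
  · rw [hγ', hγ', symplecticForm, Fin.sum_univ_succ]
    simp only [map_add, AddMonoidHom.add_apply, hζγ, form_comm halt (γ _) (ζ _), hγ.form, hζζ,
      symplecticForm, add_zero, zero_add]
    rfl
  · cases i using Fin.cases with
    | zero => rw [h0]; simpa [hζ] using hPa
    | succ i => rw [hs]; exact hγ.left i
  · cases i using Fin.cases with
    | zero => rw [h0]; simpa [hζ] using hPc
    | succ i => rw [hs]; exact hγ.right i

end IsSymplecticFamily

/-- A maximal isometry from a standard symplectic space. -/
theorem exists_maximal_symplecticFamily [Finite G] (halt : ∀ g, b g g = 0) {f : G}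
    (hf2 : 2 • f = 0) (hf : ∀ g, b f g = 0) (hP : ∀ g : G, 2 • g = 0 → P g ∨ P (g + f)) :
    ∃ (k : ℕ) (γ : (Fin k → ZMod 2 × ZMod 2) →+ G), IsSymplecticFamily b P γ ∧
      ∀ g g' : G, 2 • g = 0 → 2 • g' = 0 → (∀ v, b g (γ v) = 0) → (∀ v, b g' (γ v) = 0) →
        b g g' = 0 := by
  classical
  let Q (k : ℕ) : Prop := ∃ γ : (Fin k → ZMod 2 × ZMod 2) →+ G, IsSymplecticFamily b P γ
  have hQ0 : Q 0 := ⟨0, ⟨fun u v => by simp [symplecticForm], fun i => i.elim0, fun i => i.elim0⟩⟩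
  -- Isometries are injective, so `k < 4 ^ k ≤ |G|`, and a maximal `k` exists.
  have hQle (k : ℕ) (hk : Q k) : k ≤ Nat.card G := by
    obtain ⟨γ, hγ⟩ := hk
    have h1 := Nat.card_le_card_of_injective γ hγ.injective
    have h2 : Nat.card (Fin k → ZMod 2 × ZMod 2) = 4 ^ k := by simp
    rw [h2] at h1
    exact (Nat.lt_pow_self (by norm_num)).le.trans h1
  set k := Nat.findGreatest Q (Nat.card G) with hk
  have hQk : Q k := Nat.findGreatest_spec (Nat.zero_le _) hQ0
  have hmax : ¬ Q (k + 1) := fun h =>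
    Nat.findGreatest_is_greatest (Nat.lt_succ_self k) (hQle _ h) h
  obtain ⟨γ, hγ⟩ := hQk
  refine ⟨k, γ, hγ, fun g g' hg hg' hgγ hgγ' => ?_⟩
  by_contra hne
  have hone : b g g' = 1 := (ZMod.two_eq_zero_or_one _).resolve_left hne
  -- Translating by the radical element `f` achieves `P` without changing any value of the form.
  have hsh {x : G} (hx : 2 • x = 0) : ∃ y : G, 2 • y = 0 ∧ P y ∧ ∀ z, b y z = b x z := by
    rcases hP x hx with h | h
    · exact ⟨x, hx, h, fun _ => rfl⟩
    · exact ⟨x + f, by rw [smul_add, hx, hf2, add_zero], h, fun z => by simp [hf]⟩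
  obtain ⟨y, hy2, hPy, hy⟩ := hsh hg
  obtain ⟨y', hy2', hPy', hy'⟩ := hsh hg'
  refine hmax (hγ.exists_extension halt hy2 hy2' ?_ (fun v => by rw [hy, hgγ])
    (fun v => by rw [hy', hgγ']) hPy hPy')
  rw [hy, form_comm halt, hy', form_comm halt, hone]

/-- By maximality the complement of the image of `γ` is totally isotropic. Being also orthogonal to
that image, it lies in the radical `{0, f}`. -/
theorem exists_bijective_of_two_nsmul_eq_zero [Finite G] (halt : ∀ g, b g g = 0) {f : G}
    (hf2 : 2 • f = 0) (hf0 : f ≠ 0) (hf : ∀ g, b f g = 0)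
    (hP : ∀ g : G, 2 • g = 0 → P g ∨ P (g + f))
    (hrad : ∀ g, (∀ g', b g g' = 0) → g = 0 ∨ g = f) (h2 : ∀ g : G, 2 • g = 0) :
    ∃ (k : ℕ) (γ : (Fin k → ZMod 2 × ZMod 2) →+ G), IsSymplecticFamily b P γ ∧
      Function.Bijective (γ.coprod (zmodHom 2 f hf2)) := by
  obtain ⟨k, γ, hγ, hmax⟩ := exists_maximal_symplecticFamily halt hf2 hf hP
  refine ⟨k, γ, hγ, (injective_iff_map_eq_zero _).mpr ?_, fun g => ?_⟩
  · rintro ⟨u, s⟩ hus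
    simp only [AddMonoidHom.coprod_apply] at hus
    have hu : u = 0 := eq_zero_of_symplecticForm fun v => by
      have h := DFunLike.congr_fun (congrArg b hus) (γ v)
      rcases ZMod.two_eq_zero_or_one s with rfl | rfl <;> simpa [hf, hγ.form] using h
    subst hu
    rcases ZMod.two_eq_zero_or_one s with rfl | rfl
    · rfl
    · simp [hf0] at hus
  · obtain ⟨u, hu⟩ := hγ.exists_orthogonal g
    have hr := hrad (g + γ u) fun g' => by
      obtain ⟨u', hu'⟩ := hγ.exists_orthogonal g'
      have := hmax _ _ (h2 _) (h2 _) hu hu'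
      rwa [map_add, hu u', add_zero] at this
    have hg (x : G) (hx : g + γ u = x) : g = γ u + x := by
      rw [← hx, add_left_comm, two_nsmul_map_eq_zero, add_zero]
    rcases hr with h0 | h0
    · exact ⟨(u, 0), by simp [hg _ h0]⟩
    · exact ⟨(u, 1), by simpa using (hg _ h0).symm⟩

/-- Doubles lie in the radical, so some `a` has `2a = f`, and `G` is its 2-torsion together with a
translate by `a`. Among 2-torsion elements orthogonal to `γ`, only pairing with `a` can be
nontrivial; this leaves `f` and one further generator `t`. -/
theorem exists_bijective_of_two_nsmul_ne_zero [Finite G] (halt : ∀ g, b g g = 0) {f : G}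
    {P' : G → Prop} (hf2 : 2 • f = 0) (hf0 : f ≠ 0) (hf : ∀ g, b f g = 0)
    (hP : ∀ g : G, 2 • g = 0 → P g ∨ P (g + f)) (hP' : ∀ g : G, 2 • g = 0 → P' g ∨ P' (g + f))
    (hrad : ∀ g, (∀ g', b g g' = 0) → g = 0 ∨ g = f) (h2 : ∃ g : G, 2 • g ≠ 0) :
    ∃ (k : ℕ) (γ : (Fin k → ZMod 2 × ZMod 2) →+ G) (a t : G) (ha : 4 • a = 0) (ht : 2 • t = 0),
      IsSymplecticFamily b P γ ∧ 2 • a = f ∧ P' t ∧ b a t = 1 ∧ (∀ v, b a (γ v) = 0) ∧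
      (∀ v, b t (γ v) = 0) ∧
      Function.Bijective (((zmodHom 4 a ha).coprod (zmodHom 2 t ht)).coprod γ) := by
  obtain ⟨k, γ, hγ, hmax⟩ := exists_maximal_symplecticFamily halt hf2 hf hP
  have hdouble (g : G) : 2 • g = 0 ∨ 2 • g = f := hrad _ fun g' => by
    rw [two_nsmul, map_add, AddMonoidHom.add_apply, ZMod.two_add_self]
  obtain ⟨a₀, ha₀⟩ := h2
  obtain ⟨u₀, hu₀⟩ := hγ.exists_orthogonal a₀
  set a := a₀ + γ u₀ with ha
  have ha2 : 2 • a = f := by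
    rw [ha, smul_add, two_nsmul (γ u₀), two_nsmul_map_eq_zero, add_zero]
    exact (hdouble a₀).resolve_left ha₀
  clear_value a
  have ha4 : 4 • a = 0 := by rw [show 4 = 2 * 2 from rfl, mul_smul, ha2, hf2]
  have hsplit (g : G) : 2 • g = 0 ∨ 2 • (g + a) = 0 := by
    rcases hdouble g with h | h
    · exact Or.inl h
    · right; rw [smul_add, h, ha2, ← two_nsmul, hf2]
  -- Maximality concerns elements orthogonal to `γ`; projecting `g'` removes that restriction on it.
  have hmax' {g g' : G} (hg : 2 • g = 0) (hgγ : ∀ v, b g (γ v) = 0) (hg' : 2 • g' = 0) :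
      b g g' = 0 := by
    obtain ⟨u', hu'⟩ := hγ.exists_orthogonal g'
    have := hmax g (g' + γ u') hg
      (by rw [smul_add, hg', two_nsmul (γ u'), two_nsmul_map_eq_zero, add_zero]) hgγ hu'
    rwa [map_add, hgγ u', add_zero] at this
  have hrad' {g : G} (hg : 2 • g = 0) (hgγ : ∀ v, b g (γ v) = 0) (hga : b g a = 0) :
      g = 0 ∨ g = f := hrad g fun g' => by
    rcases hsplit g' with h | h
    · exact hmax' hg hgγ h
    · have := hmax' hg hgγ h
      rwa [map_add, hga, add_zero] at this
  -- Without such an element `a` would lie in the radical, whose elements are killed by `2`,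
  -- contradicting `2a = f ≠ 0`.
  have hext : ∃ t₀ : G, 2 • t₀ = 0 ∧ (∀ v, b t₀ (γ v) = 0) ∧ b t₀ a = 1 := by
    by_contra! hno
    have ha0 : a = 0 ∨ a = f := hrad a fun g => by
      obtain ⟨u, hu⟩ := hγ.exists_orthogonal g
      have hau : b a (g + γ u) = b a g := by rw [map_add, hu₀, add_zero]
      have hzero (x : G) (hx : 2 • x = 0) (hxγ : ∀ v, b x (γ v) = 0) : b a x = 0 := by
        rw [form_comm halt]
        exact (ZMod.two_eq_zero_or_one _).resolve_right (hno x hx hxγ)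
      rw [← hau]
      rcases hsplit (g + γ u) with h | h
      · exact hzero _ h hu
      · have := hzero _ h fun v => by rw [map_add, AddMonoidHom.add_apply, hu, hu₀, add_zero]
        rwa [map_add, halt, add_zero] at this
    rcases ha0 with h | h
    · exact hf0 (by rw [← ha2, h, smul_zero])
    · exact hf0 (by rw [← ha2, h, hf2])
  obtain ⟨t₀, ht₀, ht₀γ, ht₀a⟩ := hext
  obtain ⟨t, ht2, hPt, ht⟩ : ∃ t : G, 2 • t = 0 ∧ P' t ∧ ∀ g, b t g = b t₀ g := by
    rcases hP' t₀ ht₀ with h | h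
    · exact ⟨t₀, ht₀, h, fun _ => rfl⟩
    · exact ⟨t₀ + f, by rw [smul_add, ht₀, hf2, add_zero], h, fun z => by simp [hf]⟩
  have htγ (v) : b t (γ v) = 0 := by rw [ht, ht₀γ]
  have hta : b t a = 1 := by rw [ht, ht₀a]
  have hat : b a t = 1 := by rw [form_comm halt, hta]
  refine ⟨k, γ, a, t, ha4, ht2, hγ, ha2, hPt, hat, hu₀, htγ, (injective_iff_map_eq_zero _).mpr ?_,
    fun g => ?_⟩
  -- Pairing with `γ v`, then `a`, then `t` gives `u = 0`, `s = 0` and `m` even; `m = 2` is excluded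
  -- by `f ≠ 0`.
  · rintro ⟨⟨m, s⟩, u⟩ h0
    simp only [AddMonoidHom.coprod_apply] at h0
    have hbm (x : G) (hx : b a x = 0) : b (zmodHom 4 a ha4 m) x = 0 := by
      obtain ⟨n, rfl⟩ := ZMod.natCast_zmod_surjective m
      rw [zmodHom_natCast, map_nsmul, AddMonoidHom.nsmul_apply, hx, smul_zero]
    have hbs (x : G) : b (zmodHom 2 t ht2 s) x = s * b t x := by
      rcases ZMod.two_eq_zero_or_one s with rfl | rfl <;> simp
    have hb (x : G) : b (zmodHom 4 a ha4 m) x + s * b t x + b (γ u) x = 0 := by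
      simpa [hbs] using DFunLike.congr_fun (congrArg b h0) x
    have hu : u = 0 := eq_zero_of_symplecticForm fun v => by
      simpa [hbm _ (hu₀ v), htγ, hγ.form] using hb (γ v)
    subst hu
    have hs : s = 0 := by simpa [hbm _ (halt a), hta] using hb a
    subst hs
    have hm : ∀ m : ZMod 4, m = 0 ∨ m = 1 ∨ m = ((2 : ℕ) : ZMod 4) ∨ m = ((3 : ℕ) : ZMod 4) := by
      decide
    have hbt := hb t
    rcases hm m with rfl | rfl | rfl | rfl
    · rfl
    · simp [hat] at hbt
    · rw [zmodHom_natCast, ha2] at h0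
      simp [hf0] at h0
    · rw [zmodHom_natCast, map_nsmul, AddMonoidHom.nsmul_apply, hat, halt] at hbt
      revert hbt
      simp
      decide
  · obtain ⟨u, hu⟩ := hγ.exists_orthogonal g
    have hclose {x : G} (hx : 2 • x = 0) (hxγ : ∀ v, b x (γ v) = 0) :
        ∃ (m : ZMod 4) (s : ZMod 2), x = zmodHom 4 a ha4 m + zmodHom 2 t ht2 s := by
      have hzf {y : G} (hy : y = 0 ∨ y = f) : ∃ m : ZMod 4, y = zmodHom 4 a ha4 m := by
        rcases hy with rfl | rfl
        · exact ⟨0, by simp⟩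
        · exact ⟨(2 : ℕ), by rw [zmodHom_natCast, ha2]⟩
      rcases ZMod.two_eq_zero_or_one (b x a) with h | h
      · obtain ⟨m, hm⟩ := hzf (hrad' hx hxγ h)
        exact ⟨m, 0, by simpa using hm⟩
      · obtain ⟨m, hm⟩ := hzf (hrad' (g := x + t) (by rw [smul_add, hx, ht2, add_zero])
          (fun v => by rw [map_add, AddMonoidHom.add_apply, hxγ, htγ, add_zero])
          (by rw [map_add, AddMonoidHom.add_apply, h, hta]; exact ZMod.two_add_self 1))
        refine ⟨m, 1, ?_⟩
        rw [← hm, zmodHom_one, add_assoc, ← two_nsmul, ht2, add_zero]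
    have hg (x : G) (hx : g + γ u = x) : g = x + γ u := by
      rw [← hx, add_assoc, two_nsmul_map_eq_zero, add_zero]
    rcases hsplit (g + γ u) with h | h
    · obtain ⟨m, s, hms⟩ := hclose h hu
      exact ⟨((m, s), u), (hg _ hms).symm⟩
    · obtain ⟨m, s, hms⟩ := hclose h fun v => by
        rw [map_add, AddMonoidHom.add_apply, hu, hu₀, add_zero]
      -- The element was translated by `a` to reach the 2-torsion; `m - 1` undoes this.
      refine ⟨((m - 1, s), u), ?_⟩
      have : g + γ u = zmodHom 4 a ha4 (m - 1) + zmodHom 2 t ht2 s := by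
        rw [map_sub, zmodHom_one, sub_add_eq_add_sub, ← hms, add_sub_cancel_right]
      exact (hg _ this).symm

end Symplectic

/-! ### Homomorphisms from matrix algebras and tensor powers -/

section Homs

variable {R : Type*} [Ring R] [Algebra ℝ R]

/-- The coordinates of a real `2 × 2` matrix with respect to `1`, `A`, `B`, `A B`. -/
noncomputable def matrixTwoToQuaternionAlgebra :
    Matrix (Fin 2) (Fin 2) ℝ →ₐ[ℝ] ℍ[ℝ,(1 : ℝ),0,1] :=
  AlgHom.ofLinearMap
    { toFun := fun M =>
        ⟨(M 0 0 + M 1 1) / 2, (M 0 0 - M 1 1) / 2, (M 0 1 + M 1 0) / 2, (M 0 1 - M 1 0) / 2⟩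
      map_add' := fun M N => by ext <;> simp <;> ring
      map_smul' := fun r M => by ext <;> simp <;> ring }
    (by ext <;> simp)
    (fun M N => by ext <;> simp [Matrix.mul_apply, Fin.sum_univ_two] <;> ring)

/-- The algebra homomorphism from `M₂(ℝ)` determined by a pair of anticommuting involutions. -/
noncomputable def matrixTwoHom (x y : R) (hx : x * x = 1) (hy : y * y = 1)
    (hxy : y * x = -(x * y)) : Matrix (Fin 2) (Fin 2) ℝ →ₐ[ℝ] R :=
  AlgHom.comp (QuaternionAlgebra.Basis.liftHom
    { i := x, j := y, k := x * y
      i_mul_i := by simp [hx]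
      j_mul_j := by simp [hy]
      i_mul_j := rfl
      j_mul_i := by simp [hxy] }) matrixTwoToQuaternionAlgebra

section

variable {x y : R} (hx : x * x = 1) (hy : y * y = 1) (hxy : y * x = -(x * y))

theorem matrixTwoHom_apply (M : Matrix (Fin 2) (Fin 2) ℝ) :
    matrixTwoHom x y hx hy hxy M = ((M 0 0 + M 1 1) / 2) • (1 : R) + ((M 0 0 - M 1 1) / 2) • x +
      ((M 0 1 + M 1 0) / 2) • y + ((M 0 1 - M 1 0) / 2) • (x * y) := by
  rw [← Algebra.algebraMap_eq_smul_one]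
  rfl

theorem matrixTwoHom_left : matrixTwoHom x y hx hy hxy !![1, 0; 0, -1] = x := by
  norm_num [matrixTwoHom_apply]

theorem matrixTwoHom_right : matrixTwoHom x y hx hy hxy !![0, 1; 1, 0] = y := by
  norm_num [matrixTwoHom_apply]

theorem matrixTwoHom_mul : matrixTwoHom x y hx hy hxy !![0, 1; -1, 0] = x * y := by
  norm_num [matrixTwoHom_apply]

theorem commute_matrixTwoHom {z : R} (hzx : Commute z x) (hzy : Commute z y)
    (M : Matrix (Fin 2) (Fin 2) ℝ) : Commute z (matrixTwoHom x y hx hy hxy M) := by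
  rw [matrixTwoHom_apply]
  exact ((((Commute.one_right z).smul_right _).add_right (hzx.smul_right _)).add_right
    (hzy.smul_right _)).add_right ((hzx.mul_right hzy).smul_right _)

end

theorem commute_liftAux {J z : R} (hJ : J * J = -1) (hz : Commute z J) (c : ℂ) :
    Commute z (Complex.liftAux J hJ c) := by
  rw [Complex.liftAux_apply]
  exact (Algebra.commute_algebraMap_right _ _).add_right (hz.smul_right _)

theorem commute_tensorLift {S T : Type*} [Ring S] [Algebra ℝ S] [Ring T] [Algebra ℝ T]
    {φ : S →ₐ[ℝ] R} {ψ : T →ₐ[ℝ] R} (hφψ : ∀ s t, Commute (φ s) (ψ t)) {z : R}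
    (hφ : ∀ s, Commute z (φ s)) (hψ : ∀ t, Commute z (ψ t)) (w : S ⊗[ℝ] T) :
    Commute z (Algebra.TensorProduct.lift φ ψ hφψ w) := by
  induction w using TensorProduct.induction_on with
  | zero => rw [map_zero]; exact Commute.zero_right z
  | tmul s t => rw [Algebra.TensorProduct.lift_tmul]; exact (hφ s).mul_right (hψ t)
  | add a b ha hb => rw [map_add]; exact ha.add_right hb

/-- The algebra homomorphism from `M₂(ℂ)` determined by a pair of anticommuting involutions and a
square root of `-1` commuting with them. -/
noncomputable def complexMatrixTwoHom {J x y : R} (hJ : J * J = -1) (hx : x * x = 1)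
    (hy : y * y = 1) (hxy : y * x = -(x * y)) (hJc : ∀ z, Commute J z) :
    Matrix (Fin 2) (Fin 2) ℂ →ₐ[ℝ] R :=
  (Algebra.TensorProduct.lift (Complex.liftAux J hJ) (matrixTwoHom x y hx hy hxy)
    fun c _ => (commute_liftAux hJ (hJc _).symm c).symm).comp
    (matrixEquivTensor (Fin 2) ℝ ℂ : Matrix (Fin 2) (Fin 2) ℂ →ₐ[ℝ] ℂ ⊗[ℝ] Matrix (Fin 2) (Fin 2) ℝ)

theorem complexMatrixTwoHom_map {J x y : R} (hJ : J * J = -1) (hx : x * x = 1)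
    (hy : y * y = 1) (hxy : y * x = -(x * y)) (hJc : ∀ z, Commute J z) (c : ℂ)
    (M : Matrix (Fin 2) (Fin 2) ℝ) :
    complexMatrixTwoHom hJ hx hy hxy hJc (c • M.map (algebraMap ℝ ℂ)) =
      Complex.liftAux J hJ c * matrixTwoHom x y hx hy hxy M := by
  rw [← matrixEquivTensor_apply_symm]
  change Algebra.TensorProduct.lift _ _ (fun c _ => (commute_liftAux hJ (hJc _).symm c).symm) (matrixEquivTensor (Fin 2) ℝ ℂ
    ((matrixEquivTensor (Fin 2) ℝ ℂ).symm (c ⊗ₜ[ℝ] M))) = _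
  rw [AlgEquiv.apply_symm_apply, Algebra.TensorProduct.lift_tmul]

/-- Since `ω² = i`, the relations of `ω A` and `C` are those of `u` and `v` with `J` for `i`. The
images of `A` and `B` must be `x = ω⁻¹ u`, where `ω⁻¹` becomes `(1 - J) / √2`, and `x v`, because `B
= A C`. -/
theorem exists_complexMatrixTwoHom {J u v : R} (hJ : J * J = -1) (hJc : ∀ z, Commute J z)
    (hu : u * u = J) (hv : v * v = -1) (huv : v * u = -(u * v)) :
    ∃ χ : Matrix (Fin 2) (Fin 2) ℂ →ₐ[ℝ] R,
      χ (((1 + Complex.I) / (Real.sqrt 2 : ℂ)) • !![1, 0; 0, -1]) = u ∧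
      χ !![0, 1; -1, 0] = v ∧
      ∀ z, Commute z u → Commute z v → ∀ M, Commute z (χ M) := by
  have hs : (√2)⁻¹ * (√2)⁻¹ = (1 / 2 : ℝ) := by
    rw [← mul_inv, Real.mul_self_sqrt (by norm_num)]; norm_num
  have huJ : u * J = J * u := (hJc u).symm
  have huJ' (w : R) : u * (J * w) = J * (u * w) := by rw [← mul_assoc, huJ, mul_assoc]
  have hvJ : v * J = J * v := (hJc v).symm
  have hvJ' (w : R) : v * (J * w) = J * (v * w) := by rw [← mul_assoc, hvJ, mul_assoc]
  have hJJ (w : R) : J * (J * w) = -w := by rw [← mul_assoc, hJ]; simp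
  set x : R := (√2)⁻¹ • ((1 - J) * u) with hxdef
  have hx : x * x = 1 := by
    rw [hxdef, smul_mul_smul_comm, hs]
    simp only [sub_mul, mul_sub, one_mul, mul_assoc, hu, huJ', hJ, mul_neg, mul_one]
    module
  have hvx : v * x = -(x * v) := by
    rw [hxdef, mul_smul_comm, smul_mul_assoc]
    simp only [sub_mul, mul_sub, one_mul, mul_assoc, huv, hvJ', mul_neg]
    module
  have hy : (x * v) * (x * v) = 1 := by
    rw [mul_assoc, ← mul_assoc v, hvx, neg_mul, mul_assoc, hv, mul_neg_one, mul_neg, mul_neg,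
      neg_neg, hx]
  have hxy : (x * v) * x = -(x * (x * v)) := by
    rw [mul_assoc, hvx, mul_neg]
  refine ⟨complexMatrixTwoHom hJ hx hy hxy hJc, ?_, ?_, fun z hzu hzv M => ?_⟩
  · have h := complexMatrixTwoHom_map hJ hx hy hxy hJc ((1 + Complex.I) / (Real.sqrt 2 : ℂ))
      !![1, 0; 0, -1]
    have hM : ((1 + Complex.I) / (Real.sqrt 2 : ℂ)) •
        (!![1, 0; 0, -1] : Matrix (Fin 2) (Fin 2) ℝ).map (algebraMap ℝ ℂ) =
        ((1 + Complex.I) / (Real.sqrt 2 : ℂ)) • !![1, 0; 0, -1] := by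
      ext i j; fin_cases i <;> fin_cases j <;> simp
    rw [hM] at h
    have hω : ((1 + Complex.I) / (Real.sqrt 2 : ℂ)) = (√2)⁻¹ • (1 + Complex.I) := by
      rw [Complex.real_smul, Complex.ofReal_inv, div_eq_inv_mul]
    rw [h, matrixTwoHom_left, hω, map_smul, map_add, map_one, Complex.liftAux_apply_I, hxdef,
      smul_mul_smul_comm, hs]
    simp only [sub_mul, mul_sub, add_mul, one_mul, hJJ]
    module
  · have h := complexMatrixTwoHom_map hJ hx hy hxy hJc 1 !![0, 1; -1, 0]
    have hM : (1 : ℂ) • (!![0, 1; -1, 0] : Matrix (Fin 2) (Fin 2) ℝ).map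
        (algebraMap ℝ ℂ) = !![0, 1; -1, 0] := by
      ext i j; fin_cases i <;> fin_cases j <;> simp
    rw [hM] at h
    rw [h, matrixTwoHom_mul, map_one, one_mul, ← mul_assoc, hx, one_mul]
  · have hzx : Commute z x :=
      (((Commute.one_right z).sub_right (hJc z).symm).mul_right hzu).smul_right _
    exact commute_tensorLift (fun c _ => (commute_liftAux hJ (hJc _).symm c).symm)
      (commute_liftAux hJ (hJc z).symm) (commute_matrixTwoHom hx hy hxy hzx (hzx.mul_right hzv))
      (matrixEquivTensor (Fin 2) ℝ ℂ M)

section Power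

variable {S : Type*} [Ring S] [Algebra ℝ S]

/-- This makes the ordered product of commuting homomorphisms multiplicative. -/
theorem List.prod_ofFn_mul {M : Type*} [Monoid M] {k : ℕ} (a c : Fin k → M)
    (h : ∀ i j, i ≠ j → Commute (a i) (c j)) :
    (List.ofFn fun i => a i * c i).prod = (List.ofFn a).prod * (List.ofFn c).prod := by
  induction k with
  | zero => simp
  | succ k ih =>
    simp only [List.ofFn_succ, List.prod_cons]
    rw [ih (fun i => a i.succ) (fun i => c i.succ)
      fun i j hij => h _ _ fun h0 => hij (Fin.succ_injective _ h0)]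
    have hc : Commute (c 0) (List.ofFn fun i : Fin k => a i.succ).prod := by
      refine Commute.list_prod_right _ _ fun z hz => ?_
      obtain ⟨i, rfl⟩ := (List.mem_ofFn' _ _).mp hz
      exact (h _ _ (Fin.succ_ne_zero i)).symm
    rw [mul_assoc, ← mul_assoc (c 0), hc.eq]
    simp only [mul_assoc]

/-- The algebra homomorphism from a tensor power determined by pairwise commuting algebra
homomorphisms. -/
noncomputable def tensorPowerHom {k : ℕ} (ψ : Fin k → S →ₐ[ℝ] R)
    (hψ : ∀ i j, i ≠ j → ∀ s t, Commute (ψ i s) (ψ j t)) : (⨂[ℝ] _ : Fin k, S) →ₐ[ℝ] R :=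
  PiTensorProduct.liftAlgHom
    ((MultilinearMap.mkPiAlgebraFin ℝ k R).compLinearMap fun i => (ψ i).toLinearMap)
    (by simp)
    (fun s t => by
      simpa using List.prod_ofFn_mul (fun i => ψ i (s i)) (fun i => ψ i (t i))
        fun i j hij => hψ i j hij _ _)

theorem tensorPowerHom_tprod {k : ℕ} (ψ : Fin k → S →ₐ[ℝ] R)
    (hψ : ∀ i j, i ≠ j → ∀ s t, Commute (ψ i s) (ψ j t)) (s : Fin k → S) :
    tensorPowerHom ψ hψ (PiTensorProduct.tprod ℝ s) = (List.ofFn fun i => ψ i (s i)).prod := by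
  simp [tensorPowerHom, PiTensorProduct.liftAlgHom]

theorem commute_tensorPowerHom {k : ℕ} (ψ : Fin k → S →ₐ[ℝ] R)
    (hψ : ∀ i j, i ≠ j → ∀ s t, Commute (ψ i s) (ψ j t)) {z : R}
    (hz : ∀ i s, Commute z (ψ i s)) (w : ⨂[ℝ] _ : Fin k, S) :
    Commute z (tensorPowerHom ψ hψ w) := by
  induction w using PiTensorProduct.induction_on with
  | smul_tprod r s =>
    rw [map_smul, tensorPowerHom_tprod]
    refine Commute.smul_right (Commute.list_prod_right _ _ fun y hy => ?_) r
    obtain ⟨i, rfl⟩ := (List.mem_ofFn' _ _).mp hy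
    exact hz _ _
  | add a b ha hb => rw [map_add]; exact ha.add_right hb

theorem finite_tensorPower [FiniteDimensional ℝ S] (k : ℕ) :
    FiniteDimensional ℝ (⨂[ℝ] _ : Fin k, S) :=
  Module.Basis.finiteDimensional_of_finite
    (Basis.piTensorProduct fun _ : Fin k => Module.finBasis ℝ S)

theorem finrank_tensorPower [FiniteDimensional ℝ S] (k : ℕ) :
    Module.finrank ℝ (⨂[ℝ] _ : Fin k, S) = Module.finrank ℝ S ^ k := by
  rw [Module.finrank_eq_nat_card_basis
    (Basis.piTensorProduct fun _ : Fin k => Module.finBasis ℝ S)]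
  simp

end Power

end Homs

/-! ### Graded maps and the criterion for weak isomorphism -/

section GradedMaps

variable {G H K R S T : Type*} [AddCommGroup G] [AddCommGroup H] [AddCommGroup K]
  [Ring R] [Algebra ℝ R] [Ring S] [Algebra ℝ S] [Ring T] [Algebra ℝ T]
  {𝒜 : G → Submodule ℝ R} {ℬ : H → Submodule ℝ S} {𝒞 : K → Submodule ℝ T}

/-- An algebra homomorphism which is homogeneous along `α` and meets the units in every degree. -/
structure IsGradedMap (ℬ : H → Submodule ℝ S) (𝒜 : G → Submodule ℝ R) (φ : S →ₐ[ℝ] R)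
    (α : H →+ G) : Prop where
  map_mem : ∀ g x, x ∈ ℬ g → φ x ∈ 𝒜 (α g)
  exists_isUnit : ∀ g, ∃ x ∈ ℬ g, IsUnit (φ x)

theorem IsGradedMap.of_span {φ : S →ₐ[ℝ] R} {α : H →+ G} {e : H → S}
    (he : ∀ g, φ (e g) ∈ 𝒜 (α g)) (hu : ∀ g, IsUnit (φ (e g))) :
    IsGradedMap (fun g => Submodule.span ℝ {e g}) 𝒜 φ α := by
  refine ⟨fun g x hx => ?_, fun g => ⟨e g, Submodule.mem_span_singleton_self _, hu g⟩⟩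
  obtain ⟨r, rfl⟩ := Submodule.mem_span_singleton.mp hx
  rw [map_smul]
  exact Submodule.smul_mem _ _ (he g)

theorem IsGradedMap.tensor (h : IsDivisionGrading 𝒜) {φ : S →ₐ[ℝ] R} {ψ : T →ₐ[ℝ] R}
    {α : H →+ G} {β : K →+ G} (hφ : IsGradedMap ℬ 𝒜 φ α) (hψ : IsGradedMap 𝒞 𝒜 ψ β)
    (hφψ : ∀ s t, Commute (φ s) (ψ t)) :
    IsGradedMap (tensorGrading ℬ 𝒞) 𝒜 (Algebra.TensorProduct.lift φ ψ hφψ) (α.coprod β) := by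
  refine ⟨fun g x hx => ?_, fun g => ?_⟩
  · refine Submodule.span_induction ?_ ?_ ?_ ?_ hx
    · rintro _ ⟨s, hs, t, ht, rfl⟩
      rw [Algebra.TensorProduct.lift_tmul]
      exact h.mul_mem (hφ.map_mem _ _ hs) (hψ.map_mem _ _ ht)
    · rw [map_zero]; exact zero_mem _
    · intro x y _ _ hx hy
      rw [map_add]; exact add_mem hx hy
    · intro r x _ hx
      rw [map_smul]; exact Submodule.smul_mem _ _ hx
  · obtain ⟨s, hs, hsu⟩ := hφ.exists_isUnit g.1
    obtain ⟨t, ht, htu⟩ := hψ.exists_isUnit g.2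
    refine ⟨s ⊗ₜ t, Submodule.subset_span ⟨s, hs, t, ht, rfl⟩, ?_⟩
    rw [Algebra.TensorProduct.lift_tmul]
    exact hsu.mul htu

theorem IsGradedMap.tensorPower (h : IsDivisionGrading 𝒜) {k : ℕ} {ψ : Fin k → S →ₐ[ℝ] R}
    {γ : (Fin k → H) →+ G}
    (hγ : ∀ i, IsGradedMap ℬ 𝒜 (ψ i) (γ.comp (AddMonoidHom.single (fun _ => H) i)))
    (hψ : ∀ i j, i ≠ j → ∀ s t, Commute (ψ i s) (ψ j t)) :
    IsGradedMap (tensorPowerGrading ℬ k) 𝒜 (tensorPowerHom ψ hψ) γ := by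
  refine ⟨fun g x hx => ?_, fun g => ?_⟩
  · refine Submodule.span_induction ?_ ?_ ?_ ?_ hx
    · rintro _ ⟨s, hs, rfl⟩
      rw [tensorPowerHom_tprod]
      have := h.gradedMonoid
      have hmem := SetLike.list_prod_ofFn_mem_graded
        (A := 𝒜) (fun i => γ (Pi.single i (g i))) (fun i => ψ i (s i))
        fun i => (hγ i).map_mem _ _ (hs i)
      rwa [List.sum_ofFn, ← map_sum, Finset.univ_sum_single] at hmem
    · rw [map_zero]; exact zero_mem _
    · intro x y _ _ hx hy
      rw [map_add]; exact add_mem hx hy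
    · intro r x _ hx
      rw [map_smul]; exact Submodule.smul_mem _ _ hx
  · choose s hs hsu using fun i => (hγ i).exists_isUnit (g i)
    refine ⟨PiTensorProduct.tprod ℝ s, Submodule.subset_span ⟨s, hs, rfl⟩, ?_⟩
    rw [tensorPowerHom_tprod]
    refine List.prod_isUnit fun y hy => ?_
    obtain ⟨i, rfl⟩ := (List.mem_ofFn' _ _).mp hy
    exact hsu i

theorem ZMod.addMonoidHom_apply {n : ℕ} [NeZero n] (φ : ZMod n →+ G) (s : ZMod n) :
    φ s = s.val • φ 1 := by
  rw [← map_nsmul, nsmul_one, ZMod.natCast_zmod_val]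

/-- A criterion for a map from an algebra spanned by monomials in two homogeneous elements. -/
theorem IsGradedMap.of_monomials (h : IsDivisionGrading 𝒜) {m n : ℕ} [NeZero m] [NeZero n]
    {φ : S →ₐ[ℝ] R} {α : ZMod m × ZMod n →+ G} {a c : S} (ha : φ a ∈ 𝒜 (α (1, 0)))
    (hc : φ c ∈ 𝒜 (α (0, 1))) (hau : IsUnit (φ a)) (hcu : IsUnit (φ c)) :
    IsGradedMap (fun g : ZMod m × ZMod n => Submodule.span ℝ {a ^ g.1.val * c ^ g.2.val}) 𝒜 φ α := by
  refine IsGradedMap.of_span (fun g => ?_) fun g => ?_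
  · have hg : α g = g.1.val • α (1, 0) + g.2.val • α (0, 1) := by
      have h1 := ZMod.addMonoidHom_apply (α.comp (AddMonoidHom.inl _ _)) g.1
      have h2 := ZMod.addMonoidHom_apply (α.comp (AddMonoidHom.inr _ _)) g.2
      simp only [AddMonoidHom.comp_apply, AddMonoidHom.inl_apply, AddMonoidHom.inr_apply] at h1 h2
      rw [← h1, ← h2, ← map_add]
      simp
    rw [hg, map_mul, map_pow, map_pow]
    exact h.mul_mem (h.pow_mem ha _) (h.pow_mem hc _)
  · rw [map_mul, map_pow, map_pow]
    exact (hau.pow _).mul (hcu.pow _)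

/-- Each component is an invertible homogeneous `φ s` times the quaternions, so `φ ⊗ f` maps
components onto components. It is therefore surjective, and bijective by dimension. -/
theorem IsQuaternionGrading.weaklyIsomorphic {f : ℍ[ℝ] →ₐ[ℝ] R} (h : IsQuaternionGrading 𝒜 f)
    [FiniteDimensional ℝ R] [FiniteDimensional ℝ S] {φ : S →ₐ[ℝ] R} {α : H →+ G}
    (hφ : IsGradedMap ℬ 𝒜 φ α) (hφf : ∀ s q, Commute (φ s) (f q)) (hα : Function.Bijective α)
    (hdim : Module.finrank ℝ R = Module.finrank ℝ S * 4) :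
    WeaklyIsomorphic 𝒜 (tensorGrading ℬ gradingH) := by
  have := h.nontrivial
  set Φ := Algebra.TensorProduct.lift φ f hφf with hΦ
  have hf : IsGradedMap gradingH 𝒜 f (0 : Unit →+ G) :=
    ⟨fun _ q _ => h.map_mem q, fun _ => ⟨1, Submodule.mem_top, by simp⟩⟩
  have hΦg := hφ.tensor h.toIsDivisionGrading hf hφf
  have hmap (g : H × Unit) : (tensorGrading ℬ gradingH g).map Φ.toLinearMap = 𝒜 (α g.1) := by
    refine le_antisymm ?_ fun x hx => ?_
    · rintro _ ⟨x, hx, rfl⟩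
      simpa using hΦg.map_mem g x hx
    · obtain ⟨s, hs, hsu⟩ := hφ.exists_isUnit g.1
      obtain ⟨y, hy, rfl⟩ := h.exists_eq_mul (d := 3) h.finrank_eq (g' := 0)
        (hφ.map_mem _ _ hs) hsu.ne_zero (by simpa using hx)
      obtain ⟨q, rfl⟩ := h.exists_eq_map hy
      exact ⟨s ⊗ₜ q, Submodule.subset_span ⟨s, hs, q, Submodule.mem_top, rfl⟩, by simp [hΦ]⟩
  have hsurj : Function.Surjective Φ := by
    have htop : LinearMap.range Φ.toLinearMap = ⊤ := h.eq_top_of_le fun g => by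
      obtain ⟨g', rfl⟩ := hα.2 g
      rw [← hmap (g', ())]
      exact LinearMap.map_le_range
    exact LinearMap.range_eq_top.mp htop
  have hinj : Function.Injective Φ :=
    (LinearMap.injective_iff_surjective_of_finrank_eq_finrank (f := Φ.toLinearMap) (by
      rw [Module.finrank_tensorProduct, hdim, Quaternion.finrank_eq_four])).mpr hsurj
  let e := AlgEquiv.ofBijective Φ ⟨hinj, hsurj⟩
  let ε : H × Unit ≃+ G := AddEquiv.ofBijective (α.comp (AddMonoidHom.fst H Unit))
    (hα.comp ⟨fun p q hpq => Prod.ext hpq rfl, fun g => ⟨(g, ()), rfl⟩⟩)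
  refine ⟨e.symm, ε.symm, fun g => ?_⟩
  obtain ⟨g', rfl⟩ := ε.surjective g
  rw [ε.symm_apply_apply]
  change (𝒜 (α g'.1)).map _ = _
  rw [← hmap g', ← Submodule.map_comp]
  convert Submodule.map_id _
  exact LinearMap.ext fun x => e.symm_apply_apply x

end GradedMaps

/-! ### Classification when the centre is a graded copy of `ℂ` -/

section Classification

variable {G R : Type*} [AddCommGroup G] [Ring R] [Algebra ℝ R] {𝒜 : G → Submodule ℝ R}
  {f : ℍ[ℝ] →ₐ[ℝ] R}

theorem IsFrame.exists_mul_self_eq {g : G} {x w : R} (hx : IsFrame 𝒜 f g x) {r : ℝ} (hr : 0 < r)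
    (hxx : x * x = r • w) : ∃ y, IsFrame 𝒜 f g y ∧ y * y = w := by
  refine ⟨(√r)⁻¹ • x, hx.smul (inv_ne_zero (Real.sqrt_ne_zero'.mpr hr)), ?_⟩
  rw [smul_mul_smul_comm, hxx, smul_smul, ← mul_inv, Real.mul_self_sqrt hr.le,
    inv_mul_cancel₀ hr.ne', one_smul]

namespace IsQuaternionGrading

variable (h : IsQuaternionGrading 𝒜 f)
include h

/-- The square of a frame of degree `g` is a nonzero real multiple of `w`; rescaling leaves only its
sign. -/
theorem exists_frame_mul_self {g e : G} (hg : 2 • g = e) {w : R} (hw : IsFrame 𝒜 f e w) :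
    (∃ x, IsFrame 𝒜 f g x ∧ x * x = w) ∨ ∃ x, IsFrame 𝒜 f g x ∧ x * x = -w := by
  obtain ⟨x, hx⟩ := h.exists_frame g
  have hxx := h.frame_mul hx hx
  rw [← two_nsmul, hg] at hxx
  obtain ⟨r, hr⟩ := h.exists_eq_smul hw hxx.mem hxx.comm
  have hr0 : r ≠ 0 := by
    rintro rfl
    exact hxx.ne_zero (by simp [hr])
  rcases hr0.lt_or_gt with hlt | hgt
  · exact Or.inr (hx.exists_mul_self_eq (neg_pos.mpr hlt) (by simp [hr]))
  · exact Or.inl (hx.exists_mul_self_eq hgt hr)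

theorem isGradedMap_matrixTwoHom {α : ZMod 2 × ZMod 2 →+ G} {x y : R}
    (hxf : IsFrame 𝒜 f (α (1, 0)) x) (hyf : IsFrame 𝒜 f (α (0, 1)) y) (hx : x * x = 1)
    (hy : y * y = 1) (hxy : y * x = -(x * y)) :
    IsGradedMap gradingM2four 𝒜 (matrixTwoHom x y hx hy hxy) α := by
  refine IsGradedMap.of_monomials h.toIsDivisionGrading ?_ ?_ ?_ ?_
  · rw [matrixTwoHom_left]; exact hxf.mem
  · rw [matrixTwoHom_right]; exact hyf.mem
  · rw [matrixTwoHom_left]; exact h.isUnit_frame hxf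
  · rw [matrixTwoHom_right]; exact h.isUnit_frame hyf

theorem isGradedMap_liftAux {α : ZMod 2 →+ G} {J : R} (hJf : IsFrame 𝒜 f (α 1) J)
    (hJ : J * J = -1) : IsGradedMap gradingCtwo 𝒜 (Complex.liftAux J hJ) α := by
  refine IsGradedMap.of_span (fun s => ?_) fun s => ?_
  · rw [map_pow, Complex.liftAux_apply_I, ZMod.addMonoidHom_apply α]
    exact h.pow_mem hJf.mem _
  · rw [map_pow, Complex.liftAux_apply_I]
    exact (h.isUnit_frame hJf).pow _

/-- The classification of division gradings with quaternionic identity component, for an algebra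
whose centre is `ℝ ⊕ ℝ J` with `J` homogeneous of nontrivial degree and `J² = -1`. -/
theorem classification [FiniteDimensional ℝ R] {J : R} {e : G} (hJe : J ∈ 𝒜 e) (he : e ≠ 0)
    (hJJ : J * J = -1) (hJc : ∀ z, Commute J z)
    (hcent : ∀ g x, x ∈ 𝒜 g → x ≠ 0 → (∀ y, Commute x y) → g = 0 ∨ g = e) :
    ∃ k : ℕ, Nat.card G = 4 ^ k * 2 ∧
      (WeaklyIsomorphic 𝒜
          (tensorGrading (tensorGrading (tensorPowerGrading gradingM2four k) gradingCtwo)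
            gradingH) ∨
        (1 ≤ k ∧
          WeaklyIsomorphic 𝒜
            (tensorGrading
              (tensorGrading gradingM2eight (tensorPowerGrading gradingM2four (k - 1)))
              gradingH))) := by
  have := h.nontrivial
  -- All components are nonzero and independent in a finite-dimensional space.
  have hfin : Finite G := h.finite_of_finiteDimensional fun g hg => by
    have := h.finrank_eq g
    rw [hg, finrank_bot] at this
    omega
  have hcard := h.finrank_eq_mul_card h.finrank_eq
  have hJ0 : J ≠ 0 := by rintro rfl; simp at hJJ
  have hJf : IsFrame 𝒜 f e J := ⟨hJe, hJ0, fun q => hJc _⟩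
  have he2 : 2 • e = 0 := by
    have h1 := h.mul_mem hJe hJe
    rw [hJJ, ← two_nsmul] at h1
    exact h.degree_eq h1 (neg_mem h.one_mem) (neg_ne_zero.mpr one_ne_zero)
  obtain ⟨b, halt, hb⟩ := h.exists_commutation
  have hcomm {g g' : G} {x y : R} (hx : IsFrame 𝒜 f g x) (hy : IsFrame 𝒜 f g' y)
      (hbg : b g g' = 0) : Commute x y := by
    have := hb _ _ _ _ hx hy
    rwa [hbg, zmodSign, if_pos rfl, one_smul] at this
  have hanti {g g' : G} {x y : R} (hx : IsFrame 𝒜 f g x) (hy : IsFrame 𝒜 f g' y)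
      (hbg : b g g' = 1) : y * x = -(x * y) := by
    have := hb _ _ _ _ hx hy
    rw [hbg, zmodSign, if_neg one_ne_zero, neg_one_smul] at this
    rw [this, neg_neg]
  have hbe (g : G) : b e g = 0 := by
    obtain ⟨x, hx⟩ := h.exists_frame g
    have h1 := hb _ _ _ _ hJf hx
    rw [(hJc x).eq] at h1
    apply zmodSign_injective
    refine smul_left_injective ℝ (h.frame_mul hx hJf).ne_zero ?_
    simp only
    rw [← h1]
    simp [zmodSign]
  -- A frame of radical degree commutes with all frames and with the quaternions, which together
  -- span the algebra, so it is central.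
  have hrad (g : G) (hg : ∀ g', b g g' = 0) : g = 0 ∨ g = e := by
    obtain ⟨x, hx⟩ := h.exists_frame g
    refine hcent g x hx.mem hx.ne_zero fun y => ?_
    have htop : Subalgebra.toSubmodule (Subalgebra.centralizer ℝ {x}) = ⊤ :=
      h.eq_top_of_le fun g' z hz => by
        obtain ⟨w, hw⟩ := h.exists_frame g'
        obtain ⟨q, hq, rfl⟩ := h.exists_eq_mul (d := 3) h.finrank_eq (g' := 0) hw.mem hw.ne_zero
          (by simpa using hz)
        obtain ⟨q, rfl⟩ := h.exists_eq_map hq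
        rw [Subalgebra.mem_toSubmodule, Subalgebra.mem_centralizer_iff]
        rintro _ rfl
        exact (hcomm hx hw (hg g')).mul_right (hx.comm q)
    have hy : y ∈ Subalgebra.toSubmodule (Subalgebra.centralizer ℝ {x}) := htop ▸ Submodule.mem_top
    rw [Subalgebra.mem_toSubmodule, Subalgebra.mem_centralizer_iff] at hy
    exact hy x rfl
  -- `(x J)² = -x²`: the central `J` trades the sign of the square for a shift by `e`.
  have hshift {g : G} {x w : R} (hx : IsFrame 𝒜 f g x) (hxx : x * x = -w) :
      ∃ y, IsFrame 𝒜 f (g + e) y ∧ y * y = w := by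
    refine ⟨x * J, h.frame_mul hx hJf, ?_⟩
    rw [mul_assoc, ← mul_assoc J, (hJc x).eq, mul_assoc, hJJ, ← mul_assoc, hxx]
    simp
  let P (w : R) (g : G) : Prop := ∃ x, IsFrame 𝒜 f g x ∧ x * x = w
  have hP (g : G) (hg : 2 • g = 0) : P 1 g ∨ P 1 (g + e) :=
    (h.exists_frame_mul_self hg h.frame_one).imp id fun ⟨x, hx, hxx⟩ => hshift hx hxx
  have hP' (g : G) (hg : 2 • g = 0) : P (-1) g ∨ P (-1) (g + e) :=
    (h.exists_frame_mul_self hg h.frame_one).symm.imp id fun ⟨x, hx, hxx⟩ =>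
      hshift hx (by rw [hxx, neg_neg])
  -- Each hyperbolic pair gives anticommuting involutions, hence a copy of `M₂(ℝ)`; orthogonality of
  -- distinct pairs makes the copies commute.
  have hfam {k : ℕ} {γ : (Fin k → ZMod 2 × ZMod 2) →+ G} (hγ : IsSymplecticFamily b (P 1) γ) :
      ∃ φ : (⨂[ℝ] _ : Fin k, Matrix (Fin 2) (Fin 2) ℝ) →ₐ[ℝ] R,
        IsGradedMap (tensorPowerGrading gradingM2four k) 𝒜 φ γ ∧
        (∀ g z, IsFrame 𝒜 f g z → (∀ v, b g (γ v) = 0) → ∀ s, Commute z (φ s)) ∧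
        ∀ q s, Commute (f q) (φ s) := by
    choose x hx hxx using hγ.left
    choose y hy hyy using hγ.right
    have hxy (i : Fin k) : y i * x i = -(x i * y i) := hanti (hx i) (hy i) <| by
      rw [hγ.form, symplecticForm_single_right, Pi.single_eq_same]
    have hne {i j : Fin k} (hij : i ≠ j) (p q : ZMod 2 × ZMod 2) :
        b (γ (Pi.single i p)) (γ (Pi.single j q)) = 0 := by
      rw [hγ.form, symplecticForm]
      refine Finset.sum_eq_zero fun l _ => ?_
      rcases eq_or_ne l i with rfl | hl
      · simp [Pi.single_eq_of_ne hij]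
      · simp [Pi.single_eq_of_ne hl]
    let ψ (i : Fin k) := matrixTwoHom (x i) (y i) (hxx i) (hyy i) (hxy i)
    have hψ (i j : Fin k) (hij : i ≠ j) (s t) : Commute (ψ i s) (ψ j t) :=
      commute_matrixTwoHom _ _ _
        (commute_matrixTwoHom _ _ _ (hcomm (hx j) (hx i) (hne hij.symm _ _))
          (hcomm (hx j) (hy i) (hne hij.symm _ _)) s).symm
        (commute_matrixTwoHom _ _ _ (hcomm (hy j) (hx i) (hne hij.symm _ _))
          (hcomm (hy j) (hy i) (hne hij.symm _ _)) s).symm t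
    refine ⟨tensorPowerHom ψ hψ, IsGradedMap.tensorPower h.toIsDivisionGrading
      (fun i => h.isGradedMap_matrixTwoHom (hx i) (hy i) _ _ _) hψ, fun g z hz hgz s => ?_,
      fun q s => ?_⟩
    · exact commute_tensorPowerHom _ _ (fun i => commute_matrixTwoHom _ _ _
        (hcomm hz (hx i) (hgz _)) (hcomm hz (hy i) (hgz _))) s
    · exact commute_tensorPowerHom _ _ (fun i => commute_matrixTwoHom _ _ _
        ((hx i).comm q).symm ((hy i).comm q).symm) s
  have hdim4 (k : ℕ) : Module.finrank ℝ (⨂[ℝ] _ : Fin k, Matrix (Fin 2) (Fin 2) ℝ) = 4 ^ k := by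
    rw [finrank_tensorPower, Module.finrank_matrix]
    simp
  by_cases h2 : ∀ g : G, 2 • g = 0
  · obtain ⟨k, γ, hγ, hbij⟩ :=
      exists_bijective_of_two_nsmul_eq_zero halt he2 he hbe hP hrad h2
    have hG : Nat.card G = 4 ^ k * 2 := by
      rw [← Nat.card_eq_of_bijective _ hbij]
      simp
    obtain ⟨φ, hφ, hφz, hφf⟩ := hfam hγ
    have hC : IsGradedMap gradingCtwo 𝒜 (Complex.liftAux J hJJ) (zmodHom 2 e he2) :=
      h.isGradedMap_liftAux (by simpa using hJf) hJJ
    have hφC (s c) : Commute (φ s) (Complex.liftAux J hJJ c) :=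
      commute_liftAux hJJ (hJc _).symm c
    have := finite_tensorPower (S := Matrix (Fin 2) (Fin 2) ℝ) k
    refine ⟨k, hG, Or.inl (h.weaklyIsomorphic (hφ.tensor h.toIsDivisionGrading hC hφC)
      (fun s q => ?_) hbij ?_)⟩
    · exact (commute_tensorLift hφC (hφf q) (commute_liftAux hJJ (hJc _).symm) s).symm
    · rw [hcard, hG, Module.finrank_tensorProduct, hdim4, Complex.finrank_real_complex]
  · push Not at h2
    obtain ⟨k, γ, a, t, ha4, ht2, hγ, ha2, ⟨v, hv, hvv⟩, hat, haγ, htγ, hbij⟩ :=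
      exists_bijective_of_two_nsmul_ne_zero halt he2 he hbe hP hP' hrad h2
    -- The factor `ℤ/4 × ℤ/2` has order `4 * 2`, so it takes the place of one hyperbolic plane
    -- together with `⟨e⟩`.
    have hG : Nat.card G = 4 ^ (k + 1) * 2 := by
      rw [← Nat.card_eq_of_bijective _ hbij]
      simp
      ring
    -- A frame of degree `a` can be scaled to square to `J` or `-J`, and `-J` serves equally well as
    -- the imaginary unit.
    obtain ⟨J', hJ', hJJ', hJc', u, hu, huu⟩ : ∃ J', IsFrame 𝒜 f e J' ∧ J' * J' = -1 ∧
        (∀ z, Commute J' z) ∧ ∃ u, IsFrame 𝒜 f a u ∧ u * u = J' := by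
      rcases h.exists_frame_mul_self ha2 hJf with hu | hu
      · exact ⟨J, hJf, hJJ, hJc, hu⟩
      · refine ⟨-J, ?_, by rw [neg_mul_neg, hJJ], fun z => (hJc z).neg_left, hu⟩
        simpa using hJf.smul (r := -1) (by norm_num)
    obtain ⟨χ, hχu, hχv, hχ⟩ := exists_complexMatrixTwoHom hJJ' hJc' huu hvv (hanti hu hv hat)
    obtain ⟨φ, hφ, hφz, hφf⟩ := hfam hγ
    have hχg : IsGradedMap gradingM2eight 𝒜 χ ((zmodHom 4 a ha4).coprod (zmodHom 2 t ht2)) := by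
      refine IsGradedMap.of_monomials h.toIsDivisionGrading ?_ ?_ ?_ ?_
      · rw [hχu]; simpa using hu.mem
      · rw [hχv]; simpa using hv.mem
      · rw [hχu]; exact h.isUnit_frame hu
      · rw [hχv]; exact h.isUnit_frame hv
    have hχφ (s c) : Commute (χ s) (φ c) :=
      (hχ _ (hφz a u hu haγ c).symm (hφz t v hv htγ c).symm s).symm
    have := finite_tensorPower (S := Matrix (Fin 2) (Fin 2) ℝ) k
    refine ⟨k + 1, hG, Or.inr ⟨by omega, h.weaklyIsomorphic
      (hχg.tensor h.toIsDivisionGrading hφ hχφ) (fun s q => ?_) hbij ?_⟩⟩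
    · exact (commute_tensorLift hχφ (hχ _ (hu.comm q).symm (hv.comm q).symm) (hφf q) s).symm
    · rw [hcard, hG, Module.finrank_tensorProduct]
      change _ = _ * Module.finrank ℝ (⨂[ℝ] _ : Fin k, Matrix (Fin 2) (Fin 2) ℝ) * 4
      rw [hdim4, Module.finrank_matrix, Complex.finrank_real_complex]
      simp
      ring

end IsQuaternionGrading

end Classification

/-! ### The centre of `M_n(ℂ)` as a graded subspace -/

section Centre

/-- Comparing degrees in `z y = y z` for homogeneous `y` shows that the components of a central
element are central. -/
theorem IsDivisionGrading.exists_central_of_notMem {G R : Type*} [AddCommGroup G] [Ring R]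
    [Algebra ℝ R] {𝒜 : G → Submodule ℝ R} (h : IsDivisionGrading 𝒜) {z : R}
    (hz : ∀ y, Commute z y) (hz0 : z ∉ 𝒜 0) :
    ∃ g ≠ 0, ∃ x ∈ 𝒜 g, x ≠ 0 ∧ ∀ y, Commute x y := by
  classical
  have hint : DirectSum.IsInternal 𝒜 := by convert h.isInternal
  let : DirectSum.Decomposition 𝒜 := hint.chooseDecomposition
  have : SetLike.GradedMonoid 𝒜 := h.gradedMonoid
  let : GradedRing 𝒜 := { h.gradedMonoid, hint.chooseDecomposition with }
  by_contra! hno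
  have hcomp (g : G) (y : R) : Commute (DirectSum.decompose 𝒜 z g : R) y := by
    have htop : Subalgebra.toSubmodule
        (Subalgebra.centralizer ℝ {(DirectSum.decompose 𝒜 z g : R)}) = ⊤ :=
      h.eq_top_of_le fun g' y hy => by
        rw [Subalgebra.mem_toSubmodule, Subalgebra.mem_centralizer_iff]
        rintro _ rfl
        rw [← DirectSum.coe_decompose_mul_add_of_right_mem 𝒜 hy, (hz y).eq, add_comm g g',
          DirectSum.coe_decompose_mul_add_of_left_mem 𝒜 hy]
    have hy : y ∈ Subalgebra.toSubmodule
        (Subalgebra.centralizer ℝ {(DirectSum.decompose 𝒜 z g : R)}) := htop ▸ Submodule.mem_top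
    rw [Subalgebra.mem_toSubmodule, Subalgebra.mem_centralizer_iff] at hy
    exact hy _ rfl
  apply hz0
  rw [← DirectSum.sum_support_decompose 𝒜 z]
  refine sum_mem fun g _ => ?_
  rcases eq_or_ne g 0 with rfl | hg
  · exact (DirectSum.decompose 𝒜 z 0).2
  · by_cases hx : (DirectSum.decompose 𝒜 z g : R) = 0
    · rw [hx]; exact zero_mem _
    · obtain ⟨y, hy⟩ := hno g hg _ (DirectSum.decompose 𝒜 z g).2 hx
      exact absurd (hcomp g y) hy

theorem Matrix.exists_eq_smul_one_of_commute {n : ℕ} {x : Matrix (Fin n) (Fin n) ℂ}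
    (hx : ∀ y, Commute x y) : ∃ c : ℂ, x = c • 1 := by
  obtain ⟨c, hc⟩ := Matrix.mem_range_scalar_of_commute_single (M := x)
    fun i j _ => (hx _).symm
  exact ⟨c, by rw [← hc, Matrix.smul_one_eq_diagonal]; rfl⟩

theorem Matrix.complex_smul_one_eq {n : ℕ} (c : ℂ) :
    c • (1 : Matrix (Fin n) (Fin n) ℂ) =
      c.re • (1 : Matrix (Fin n) (Fin n) ℂ) + c.im • (Complex.I • 1) := by
  conv_lhs => rw [← Complex.re_add_im c]
  rw [add_smul, mul_smul]
  rfl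

theorem Matrix.commute_smul_one {n : ℕ} (c : ℂ) (y : Matrix (Fin n) (Fin n) ℂ) :
    Commute (c • 1) y :=
  (Commute.one_left y).smul_left c

/-- Only real scalars are central in `ℍ`, so `i·1` is not of degree `0`, and there is a central
homogeneous `c·1` of degree `e ≠ 0`. In `2 Re(c) c = c² + |c|²` the left side has degree `e` and the
right side degrees `2e` and `0`, so `Re c = 0` and `c` is a real multiple of `i`. -/
theorem IsQuaternionGrading.exists_I_mem {G : Type*} [AddCommGroup G] {n : ℕ}
    {𝒜 : G → Submodule ℝ (Matrix (Fin n) (Fin n) ℂ)} {f : ℍ[ℝ] →ₐ[ℝ] Matrix (Fin n) (Fin n) ℂ}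
    (h : IsQuaternionGrading 𝒜 f) : ∃ e ≠ 0, Complex.I • 1 ∈ 𝒜 e := by
  have := h.nontrivial
  have hI : Complex.I • (1 : Matrix (Fin n) (Fin n) ℂ) ∉ 𝒜 0 := fun hI => by
    obtain ⟨r, hr⟩ := h.exists_eq_smul_one hI fun _ => Matrix.commute_smul_one _ _
    have : Complex.I = (r : ℂ) := smul_left_injective ℂ (one_ne_zero (α := Matrix (Fin n) (Fin n) ℂ))
      hr
    have := congrArg Complex.im this
    simp at this
  obtain ⟨e, he, w, hw, hw0, hwc⟩ :=
    h.exists_central_of_notMem (Matrix.commute_smul_one Complex.I) hI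
  obtain ⟨c, rfl⟩ := Matrix.exists_eq_smul_one_of_commute hwc
  have hc0 : c ≠ 0 := by rintro rfl; simp at hw0
  have hquad : ((2 * c.re) • (c • 1) : Matrix (Fin n) (Fin n) ℂ) =
      (c • 1) * (c • 1) + (c.re ^ 2 + c.im ^ 2) • 1 := by
    have hc : (2 * c.re : ℂ) * c = c * c + (c.re ^ 2 + c.im ^ 2) := by
      apply Complex.ext
      · simp [pow_two]; ring
      · simp [pow_two]; ring
    have h1 : ((2 * c.re) • (c • 1) : Matrix (Fin n) (Fin n) ℂ) = ((2 * c.re : ℂ) * c) • 1 := by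
      rw [← Complex.coe_smul, Complex.ofReal_mul, Complex.ofReal_ofNat, mul_smul _ c]
    have h2 : ((c.re ^ 2 + c.im ^ 2) • 1 : Matrix (Fin n) (Fin n) ℂ) =
        ((c.re ^ 2 + c.im ^ 2 : ℂ)) • 1 := by
      rw [← Complex.coe_smul]; simp
    rw [h1, h2, hc, smul_mul_smul_comm, one_mul, add_smul]
  have hzero := h.eq_zero_of_eq_add (Submodule.smul_mem _ (2 * c.re) hw) (h.mul_mem hw hw)
    (Submodule.smul_mem _ (c.re ^ 2 + c.im ^ 2) h.one_mem) (by simpa using he) he.symm hquad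
  have hre : c.re = 0 := by simpa [hw0] using hzero
  have him : c.im ≠ 0 := fun him => hc0 (Complex.ext hre him)
  refine ⟨e, he, ?_⟩
  have := Submodule.smul_mem _ c.im⁻¹ hw
  rwa [Matrix.complex_smul_one_eq, hre, zero_smul, zero_add, inv_smul_smul₀ him] at this

theorem IsQuaternionGrading.matrix_classification {G : Type*} [AddCommGroup G] {n : ℕ}
    {𝒜 : G → Submodule ℝ (Matrix (Fin n) (Fin n) ℂ)} {f : ℍ[ℝ] →ₐ[ℝ] Matrix (Fin n) (Fin n) ℂ}
    (h : IsQuaternionGrading 𝒜 f) :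
    ∃ k : ℕ, n = 2 ^ (k + 1) ∧
      (WeaklyIsomorphic 𝒜
          (tensorGrading (tensorGrading (tensorPowerGrading gradingM2four k) gradingCtwo)
            gradingH) ∨
        (1 ≤ k ∧
          WeaklyIsomorphic 𝒜
            (tensorGrading
              (tensorGrading gradingM2eight (tensorPowerGrading gradingM2four (k - 1)))
              gradingH))) := by
  obtain ⟨e, he, hIe⟩ := h.exists_I_mem
  have hcent (g) (x) (hx : x ∈ 𝒜 g) (hx0 : x ≠ 0) (hxc : ∀ y, Commute x y) : g = 0 ∨ g = e := by
    by_contra! hg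
    obtain ⟨c, hc⟩ := Matrix.exists_eq_smul_one_of_commute hxc
    rw [Matrix.complex_smul_one_eq] at hc
    exact hx0 (h.eq_zero_of_eq_add hx (Submodule.smul_mem _ _ h.one_mem)
      (Submodule.smul_mem _ _ hIe) hg.1.symm hg.2.symm hc)
  have hII : (Complex.I • 1 : Matrix (Fin n) (Fin n) ℂ) * (Complex.I • 1) = -1 := by
    rw [smul_mul_smul_comm, Complex.I_mul_I]; simp
  obtain ⟨k, hk, hW⟩ := h.classification hIe he hII (Matrix.commute_smul_one _) hcent
  refine ⟨k, ?_, hW⟩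
  have : Finite G := Nat.finite_of_card_ne_zero (by rw [hk]; positivity)
  have hdim := h.finrank_eq_mul_card h.finrank_eq
  rw [hk, Module.finrank_matrix, Complex.finrank_real_complex] at hdim
  simp only [Fintype.card_fin] at hdim
  -- The dimension count reads `2 n² = 4 ^ k * 2 * 4`, that is, `n² = (2 ^ (k + 1))²`.
  refine Nat.pow_left_injective two_ne_zero ?_
  have h4 : (2 ^ (k + 1)) ^ 2 = 4 ^ k * 4 := by
    rw [← pow_mul, mul_comm, pow_mul]; norm_num [pow_succ]
  simp only
  rw [h4]
  nlinarith

end Centre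

/-! ### Construction of gradings on `M_n(ℂ)` for `n` a power of two -/

section Existence

/-- A real algebra which is a twisted group algebra over the quaternions. -/
def IsQuaternionTwisted (R : Type*) [Ring R] [Algebra ℝ R] : Prop :=
  ∃ (G : Type) (_ : AddCommGroup G) (_ : Finite G) (f : ℍ[ℝ] →ₐ[ℝ] R) (E : G → R),
    E 0 = 1 ∧ (∀ g, IsUnit (E g)) ∧ (∀ g q, Commute (E g) (f q)) ∧
    (∀ g g', ∃ r : ℝ, E g * E g' = r • E (g + g')) ∧
    Submodule.span ℝ {x | ∃ g q, x = E g * f q} = ⊤ ∧ Module.finrank ℝ R = Nat.card G * 4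

/-- The components are `E g · f(ℍ)`. They span, and their dimensions add up to that of `R`, so the
sum is direct. -/
theorem IsQuaternionTwisted.exists_isDivisionGrading {R : Type*} [Ring R] [Algebra ℝ R]
    (h : IsQuaternionTwisted R) :
    ∃ (G : Type) (_ : AddCommGroup G) (𝒜 : G → Submodule ℝ R),
      IsDivisionGrading 𝒜 ∧ ∀ g, Module.finrank ℝ (𝒜 g) = 4 := by
  classical
  obtain ⟨G, _, hG, f, E, h0, hu, hc, hm, hs, hd⟩ := h
  cases nonempty_fintype G
  have hpos : 0 < Module.finrank ℝ R := by
    rw [hd]; exact Nat.mul_pos Nat.card_pos (by norm_num)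
  have : FiniteDimensional ℝ R := Module.finite_of_finrank_pos hpos
  have : Nontrivial R := Module.nontrivial_of_finrank_pos hpos
  have hf : Function.Injective f := (f : ℍ[ℝ] →+* R).injective
  let L (g : G) : ℍ[ℝ] →ₗ[ℝ] R := (LinearMap.mulLeft ℝ (E g)).comp f.toLinearMap
  have hL (g : G) (q : ℍ[ℝ]) : L g q = E g * f q := rfl
  let 𝒜 (g : G) : Submodule ℝ R := LinearMap.range (L g)
  have h4 (g : G) : Module.finrank ℝ (𝒜 g) = 4 := by
    rw [LinearMap.finrank_range_of_inj, Quaternion.finrank_eq_four]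
    exact fun p q hpq => hf ((hu g).mul_right_injective hpq)
  refine ⟨G, inferInstance, 𝒜, ⟨{ one_mem := ⟨1, ?_⟩, mul_mem := ?_ }, ?_, ?_⟩, h4⟩
  · rw [hL, h0, map_one, one_mul]
  · rintro g g' _ _ ⟨p, rfl⟩ ⟨q, rfl⟩
    obtain ⟨r, hr⟩ := hm g g'
    refine ⟨r • (p * q), ?_⟩
    rw [hL, hL, hL, mul_assoc, ← mul_assoc (f p), ← (hc g' p).eq, mul_assoc, ← mul_assoc, hr]
    simp
  · have htop : LinearMap.range (DirectSum.coeLinearMap 𝒜) = ⊤ := by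
      rw [← top_le_iff, ← hs, Submodule.span_le]
      rintro _ ⟨g, q, rfl⟩
      exact ⟨DirectSum.lof ℝ G (fun g => 𝒜 g) g ⟨_, q, rfl⟩, by
        rw [DirectSum.coeLinearMap_lof]; rfl⟩
    have hsurj := LinearMap.range_eq_top.mp htop
    let e := DirectSum.linearEquivFunOnFintype ℝ G fun g => 𝒜 g
    let C : ((g : G) → 𝒜 g) →ₗ[ℝ] R := (DirectSum.coeLinearMap 𝒜).comp e.symm.toLinearMap
    have hfr : Module.finrank ℝ ((g : G) → 𝒜 g) = Module.finrank ℝ R := by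
      rw [Module.finrank_pi_fintype, hd]
      simp [h4]
    have hinj : Function.Injective C :=
      (LinearMap.injective_iff_surjective_of_finrank_eq_finrank hfr).mpr
        (hsurj.comp e.symm.surjective)
    have hb : Function.Bijective (DirectSum.coeLinearMap 𝒜) := by
      refine ⟨fun x y hxy => e.injective (hinj ?_), hsurj⟩
      simpa [C] using hxy
    exact hb
  · rintro g _ ⟨q, rfl⟩ hx
    rw [hL] at hx ⊢
    refine (hu g).mul ((IsUnit.mk0 q ?_).map f)
    rintro rfl
    simp at hx

theorem IsQuaternionTwisted.of_algEquiv {R S : Type*} [Ring R] [Algebra ℝ R] [Ring S]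
    [Algebra ℝ S] (h : IsQuaternionTwisted R) (e : R ≃ₐ[ℝ] S) : IsQuaternionTwisted S := by
  obtain ⟨G, _, hG, f, E, h0, hu, hc, hm, hs, hd⟩ := h
  refine ⟨G, inferInstance, hG, (e : R →ₐ[ℝ] S).comp f, fun g => e (E g), by simp [h0],
    fun g => (hu g).map e, fun g q => (hc g q).map e, fun g g' => ?_, ?_, ?_⟩
  · obtain ⟨r, hr⟩ := hm g g'
    exact ⟨r, by rw [← map_mul, hr, map_smul]⟩
  · have := congrArg (Submodule.map e.toLinearMap) hs
    rw [Submodule.map_span, Submodule.map_top, LinearMap.range_eq_top.mpr e.surjective] at this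
    rw [← this]
    congr 1
    ext x
    constructor
    · rintro ⟨g, q, rfl⟩
      exact ⟨E g * f q, ⟨g, q, rfl⟩, map_mul e _ _⟩
    · rintro ⟨_, ⟨g, q, rfl⟩, rfl⟩
      exact ⟨g, q, map_mul e _ _⟩
  · rw [← hd, e.toLinearEquiv.finrank_eq]

theorem ZMod.val_one_two : (1 : ZMod 2).val = 1 := rfl

/-- The monomials `A ^ a * B ^ b` in `M₂(ℝ)`. -/
noncomputable def matrixTwoMonomial (p : ZMod 2 × ZMod 2) : Matrix (Fin 2) (Fin 2) ℝ :=
  !![1, 0; 0, -1] ^ p.1.val * !![0, 1; 1, 0] ^ p.2.val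

theorem isUnit_matrixTwoMonomial (p : ZMod 2 × ZMod 2) : IsUnit (matrixTwoMonomial p) := by
  refine IsUnit.mul (IsUnit.pow _ ?_) (IsUnit.pow _ ?_) <;>
    simp [Matrix.isUnit_iff_isUnit_det, Matrix.det_fin_two_of]

/-- The sign comes from moving `B` past `A`, as `B A = -A B`. -/
theorem matrixTwoMonomial_mul (p q : ZMod 2 × ZMod 2) :
    matrixTwoMonomial p * matrixTwoMonomial q =
      zmodSign (p.2 * q.1) • matrixTwoMonomial (p + q) := by
  have h11 : (1 + 1 : ZMod 2) = 0 := rfl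
  obtain ⟨a, b⟩ := p
  obtain ⟨c, d⟩ := q
  rcases ZMod.two_eq_zero_or_one a with rfl | rfl <;>
    rcases ZMod.two_eq_zero_or_one b with rfl | rfl <;>
    rcases ZMod.two_eq_zero_or_one c with rfl | rfl <;>
    rcases ZMod.two_eq_zero_or_one d with rfl | rfl <;>
    simp [matrixTwoMonomial, zmodSign, h11, ZMod.val_one_two, Matrix.one_fin_two]

theorem mem_span_matrixTwoMonomial (M : Matrix (Fin 2) (Fin 2) ℝ) :
    M ∈ Submodule.span ℝ (Set.range matrixTwoMonomial) := by
  have hM : M = ((M 0 0 + M 1 1) / 2) • matrixTwoMonomial (0, 0) +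
      ((M 0 0 - M 1 1) / 2) • matrixTwoMonomial (1, 0) +
      ((M 0 1 + M 1 0) / 2) • matrixTwoMonomial (0, 1) +
      ((M 0 1 - M 1 0) / 2) • matrixTwoMonomial (1, 1) := by
    ext i j
    fin_cases i <;> fin_cases j <;>
      simp [matrixTwoMonomial, ZMod.val_one_two, Matrix.one_fin_two] <;> ring
  have h (p) := Submodule.subset_span (R := ℝ) (Set.mem_range_self (f := matrixTwoMonomial) p)
  rw [hM]
  exact add_mem (add_mem (add_mem (Submodule.smul_mem _ _ (h _)) (Submodule.smul_mem _ _ (h _)))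
    (Submodule.smul_mem _ _ (h _))) (Submodule.smul_mem _ _ (h _))

theorem IsQuaternionTwisted.tensor_matrixTwo {R : Type*} [Ring R] [Algebra ℝ R]
    (h : IsQuaternionTwisted R) : IsQuaternionTwisted (R ⊗[ℝ] Matrix (Fin 2) (Fin 2) ℝ) := by
  obtain ⟨G, _, hG, f, E, h0, hu, hc, hm, hs, hd⟩ := h
  refine ⟨G × (ZMod 2 × ZMod 2), inferInstance, inferInstance,
    Algebra.TensorProduct.includeLeft.comp f, fun g => E g.1 ⊗ₜ matrixTwoMonomial g.2, ?_,
    fun g => ?_, fun g q => ?_, fun g g' => ?_, ?_, ?_⟩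
  · simp [h0, matrixTwoMonomial, Algebra.TensorProduct.one_def]
  · have h1 := (hu g.1).map (Algebra.TensorProduct.includeLeft : R →ₐ[ℝ] R ⊗[ℝ] Matrix (Fin 2) (Fin 2) ℝ)
    have h2 := (isUnit_matrixTwoMonomial g.2).map
      (Algebra.TensorProduct.includeRight : _ →ₐ[ℝ] R ⊗[ℝ] Matrix (Fin 2) (Fin 2) ℝ)
    simpa using h1.mul h2
  · simpa using (hc g.1 q).tmul (Commute.one_right (matrixTwoMonomial g.2))
  · obtain ⟨r, hr⟩ := hm g.1 g'.1
    refine ⟨r * zmodSign (g.2.2 * g'.2.1), ?_⟩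
    rw [Algebra.TensorProduct.tmul_mul_tmul, hr, matrixTwoMonomial_mul, TensorProduct.smul_tmul_smul]
    rfl
  · rw [← top_le_iff, ← TensorProduct.span_tmul_eq_top, Submodule.span_le]
    rintro _ ⟨x, M, rfl⟩
    have hx : x ∈ Submodule.span ℝ {x | ∃ g q, x = E g * f q} := hs ▸ Submodule.mem_top
    induction hx using Submodule.span_induction with
    | mem x hx =>
      obtain ⟨g, q, rfl⟩ := hx
      have hM := mem_span_matrixTwoMonomial M
      induction hM using Submodule.span_induction with
      | mem M hM =>
        obtain ⟨p, rfl⟩ := hM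
        exact Submodule.subset_span ⟨(g, p), q, by simp⟩
      | zero => rw [TensorProduct.tmul_zero]; exact zero_mem _
      | add a b _ _ ha hb => rw [TensorProduct.tmul_add]; exact add_mem ha hb
      | smul r a _ ha => rw [TensorProduct.tmul_smul]; exact Submodule.smul_mem _ _ ha
    | zero => rw [TensorProduct.zero_tmul]; exact zero_mem _
    | add a b _ _ ha hb => rw [TensorProduct.add_tmul]; exact add_mem ha hb
    | smul r a _ ha => rw [← TensorProduct.smul_tmul']; exact Submodule.smul_mem _ _ ha
  · rw [Module.finrank_tensorProduct, hd, Module.finrank_matrix, Nat.card_prod]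
    simp [mul_comm]

/-- This is `M₂(ℂ) = ℂ ⊗ ℍ`: the quaternions embed in the standard way, and the twisted group
algebra is `ℂ` over `ℤ/2`. -/
theorem isQuaternionTwisted_complexMatrixTwo :
    IsQuaternionTwisted (Matrix (Fin 2) (Fin 2) ℂ) := by
  have hI : (Complex.I • 1 : Matrix (Fin 2) (Fin 2) ℂ) * (Complex.I • 1) = -1 := by
    rw [smul_mul_smul_comm, Complex.I_mul_I]; simp
  let B : QuaternionAlgebra.Basis (Matrix (Fin 2) (Fin 2) ℂ) (-1 : ℝ) 0 (-1) :=
    { i := !![Complex.I, 0; 0, -Complex.I]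
      j := !![0, 1; -1, 0]
      k := !![0, Complex.I; Complex.I, 0]
      i_mul_i := by simp [Matrix.one_fin_two]
      j_mul_j := by simp [Matrix.one_fin_two]
      i_mul_j := by simp
      j_mul_i := by simp }
  let f : ℍ[ℝ] →ₐ[ℝ] Matrix (Fin 2) (Fin 2) ℂ := B.liftHom
  have hf (q : ℍ[ℝ]) : f q = !![q.re + q.imI * Complex.I, q.imJ + q.imK * Complex.I;
      -q.imJ + q.imK * Complex.I, q.re - q.imI * Complex.I] := by
    change B.lift q = _
    simp only [QuaternionAlgebra.Basis.lift, B, Algebra.algebraMap_eq_smul_one, Matrix.one_fin_two]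
    ext i j
    fin_cases i <;> fin_cases j <;> simp [sub_eq_add_neg]
  let E (s : ZMod 2) : Matrix (Fin 2) (Fin 2) ℂ := (Complex.I • 1) ^ s.val
  have hE0 : E 0 = 1 := rfl
  have hE1 : E 1 = Complex.I • 1 := pow_one _
  refine ⟨ZMod 2, inferInstance, inferInstance, f, E, hE0, fun s => IsUnit.pow _ ?_,
    fun s q => (Matrix.commute_smul_one _ _).pow_left _, fun s t => ?_, ?_, ?_⟩
  · exact ⟨⟨Complex.I • 1, -(Complex.I • 1), by rw [mul_neg, hI, neg_neg],
      by rw [neg_mul, hI, neg_neg]⟩, rfl⟩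
  · rcases ZMod.two_eq_zero_or_one s with rfl | rfl
    · exact ⟨1, by simp [hE0]⟩
    · rcases ZMod.two_eq_zero_or_one t with rfl | rfl
      · exact ⟨1, by simp [hE0]⟩
      · exact ⟨-1, by rw [hE1, hI, show (1 + 1 : ZMod 2) = 0 from rfl, hE0]; simp⟩
  · rw [← top_le_iff]
    intro M _
    have hsm (c : ℂ) (q : ℍ[ℝ]) : c • f q ∈ Submodule.span ℝ {x | ∃ g q, x = E g * f q} := by
      have h0 : f q ∈ Submodule.span ℝ {x | ∃ g q, x = E g * f q} :=
        Submodule.subset_span ⟨0, q, by rw [hE0, one_mul]⟩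
      have h1 : Complex.I • f q ∈ Submodule.span ℝ {x | ∃ g q, x = E g * f q} :=
        Submodule.subset_span ⟨1, q, by rw [hE1, smul_mul_assoc, one_mul]⟩
      have hc : c • f q = c.re • f q + c.im • (Complex.I • f q) := by
        conv_lhs => rw [← Complex.re_add_im c, add_smul, mul_smul]
        rfl
      rw [hc]
      exact add_mem (Submodule.smul_mem _ _ h0) (Submodule.smul_mem _ _ h1)
    obtain ⟨qi, hqi⟩ := exists_quaternion_components 0 1 0 0
    obtain ⟨qj, hqj⟩ := exists_quaternion_components 0 0 1 0
    obtain ⟨qk, hqk⟩ := exists_quaternion_components 0 0 0 1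
    -- The complex coordinates of `M` in the basis `1, i, j, k`; the factor `-i` inverts the `i` in
    -- the matrices of `i` and `k`.
    have hM : M = ((M 0 0 + M 1 1) / 2) • f 1 + (-Complex.I * (M 0 0 - M 1 1) / 2) • f qi +
        ((M 0 1 - M 1 0) / 2) • f qj + (-Complex.I * (M 0 1 + M 1 0) / 2) • f qk := by
      simp only [hf, hqi, hqj, hqk]
      ext i j
      fin_cases i <;> fin_cases j <;>
        simp <;> ring_nf <;> simp <;> ring_nf
    rw [hM]
    exact add_mem (add_mem (add_mem (hsm _ _) (hsm _ _)) (hsm _ _)) (hsm _ _)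
  · rw [Module.finrank_matrix, Complex.finrank_real_complex]
    simp

/-- The induction step is `M_N(ℂ) ⊗ M₂(ℝ) ≅ M_{2N}(ℂ)`, through block matrices. -/
theorem isQuaternionTwisted_complexMatrix (m : ℕ) :
    IsQuaternionTwisted (Matrix (Fin (2 ^ (m + 1))) (Fin (2 ^ (m + 1))) ℂ) := by
  induction m with
  | zero => exact isQuaternionTwisted_complexMatrixTwo
  | succ m ih =>
    refine ih.tensor_matrixTwo.of_algEquiv
      (((matrixEquivTensor (Fin 2) ℝ (Matrix (Fin (2 ^ (m + 1))) (Fin (2 ^ (m + 1))) ℂ)).symm.trans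
        (Matrix.compAlgEquiv (Fin 2) (Fin (2 ^ (m + 1))) ℂ ℝ)).trans
        (Matrix.reindexAlgEquiv ℝ ℂ (finProdFinEquiv.trans (finCongr ?_))))
    rw [pow_succ' 2 (m + 1)]

end Existence

theorem mainTheorem7 (n : ℕ) :
    ((∃ (G : Type) (_ : AddCommGroup G) (𝒜 : G → Submodule ℝ (Matrix (Fin n) (Fin n) ℂ)),
        IsDivisionGrading 𝒜 ∧ ∀ g, Module.finrank ℝ (𝒜 g) = 4) ↔
      ∃ m : ℕ, 1 ≤ m ∧ n = 2 ^ m) ∧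
    ∀ (G : Type*) [AddCommGroup G] (𝒜 : G → Submodule ℝ (Matrix (Fin n) (Fin n) ℂ)),
      IsDivisionGrading 𝒜 → (∀ g, Module.finrank ℝ (𝒜 g) = 4) →
      (∃ f : ℍ[ℝ] →ₐ[ℝ] Matrix (Fin n) (Fin n) ℂ,
        Function.Injective f ∧ LinearMap.range f.toLinearMap = 𝒜 0) ∧
      ∃ k : ℕ, n = 2 ^ (k + 1) ∧
        (WeaklyIsomorphic 𝒜
            (tensorGrading (tensorGrading (tensorPowerGrading gradingM2four k) gradingCtwo)
              gradingH) ∨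
          (1 ≤ k ∧
            WeaklyIsomorphic 𝒜
              (tensorGrading
                (tensorGrading gradingM2eight (tensorPowerGrading gradingM2four (k - 1)))
                gradingH))) := by
  refine ⟨⟨?_, ?_⟩, fun G _ 𝒜 h h4 => ?_⟩
  · rintro ⟨G, _, 𝒜, h, h4⟩
    obtain ⟨f, hinj, hrange⟩ := h.exists_quaternion_algHom h4
    obtain ⟨k, hk, _⟩ := IsQuaternionGrading.matrix_classification ⟨h, h4, hinj, hrange⟩
    exact ⟨k + 1, by omega, hk⟩
  · rintro ⟨m, hm, rfl⟩
    obtain ⟨m, rfl⟩ := Nat.exists_eq_add_of_le' hm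
    exact (isQuaternionTwisted_complexMatrix m).exists_isDivisionGrading
  · obtain ⟨f, hinj, hrange⟩ := h.exists_quaternion_algHom h4
    exact ⟨⟨f, hinj, hrange⟩,
      IsQuaternionGrading.matrix_classification ⟨h, h4, hinj, hrange⟩⟩
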